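/- Let $f_1,\dots,f_m:\mathbb R^n\to\mathbb R$ be $C^1$ functions such that $\nabla f_j$ is $L_j$-Lipschitz, and assume that for some $j_0$ all level sets $\{f_{j_0}\le\alpha\}$, $\alpha\in\mathbb R$, are bounded. Put $C(x)=\operatorname{conv}\{\nabla f_1(x),\dots,\nabla f_m(x)\}$, let $\operatorname{proj}_C$ be the Euclidean projection onto $C$, and fix $\theta_0>0$ and $x_0,z_0\in\mathbb R^n$. For a step size $\tau>0$ consider the multiobjective accelerated proximal gradient method (APG) with initial parameter $\theta^\tau_0=\sqrt\tau/\theta_0$: $x_0^\tau=x_0$, $z_0^\tau=z_0$, $y_0^\tau=x_0+\theta_0^\tau(z_0-x_0)$ (so $y_0^\tau=x_0^\tau$, as in the original method, when $z_0=x_0$) and, for $k\ge0$, $$\frac1{\theta^\tau_{k+1}}=\sqrt{\frac1{(\theta^\tau_k)^2}+\frac14}+\frac12,\qquad y^\tau_{k+1}=x^\tau_{k+1}+\theta^\tau_{k+1}\Big(\frac1{\theta^\tau_k}-1\Big)(x^\tau_{k+1}-x^\tau_k),$$ $$x^\tau_{k+1}=\operatorname*{argmin}_{w\in\mathbb R^n}\max_{1\le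 j\le m}\Big\{\langle\nabla f_j(y^\tau_k),w-y^\tau_k\rangle+f_j(y^\tau_k)-f_j(x^\tau_k)+\tfrac1{2\tau}\|w-y^\tau_k\|^2\Big\},$$ with $z^\tau_{k+1}=x^\tau_{k+1}+(1/\theta^\tau_k-1)(x^\tau_{k+1}-x^\tau_k)$. Consider on $[0,\infty)$ the system $$[\theta^2]'=\theta,\qquad \theta X'=Z-X,\qquad Z'=-\theta\,\operatorname{proj}_{C(X)}\Big(\frac{3X'-2Z'}{2\theta}\Big)\tag{1}$$ with $\theta(0)=\theta_0$, $X(0)=x_0$, $Z(0)=z_0$. A solution of (1) is a triple $(\theta,X,Z)$ satisfying the initial conditions, the first two equations for every $t\ge0$ and the third for almost every $t>0$, with $Z$ locally absolutely continuous. Write $\Gamma^\tau$ for the piecewise constant path that has the value $(\sqrt\tau/\theta^\tau_k,\,x^\tau_k,\,z^\tau_k)$ for $t\in[\sqrt\tau\,k,\sqrt\tau\,(k+1))$. Then: 1. For every $\tau>0$ the sequences of (APG) exist and are unique. 2. The continuous-time limit of (APG) as $\tau\to0$, with $t=\sqrt\tau\,k$, is (1): every sequence $\tau_i\to0^+$ has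 a subsequence along which $\Gamma^{\tau_i}$ converges, uniformly on every $[0,T]$, to a solution of (1); whenever $\Gamma^{\tau_i}$ converges uniformly on every $[0,T]$ along some $\tau_i\to0^+$, the limit is a solution of (1); and if $(\theta,X,Z)$ is a solution of (1) and every solution of (1) has the same component $X$ on $[0,\infty)$, then $\Gamma^\tau\to(\theta,X,Z)$ uniformly on every $[0,T]$ as $\tau\to0^+$. 3. System (1) is equivalent to $$X''(t)+\frac{3}{t+2\theta_0}X'(t)+\operatorname{proj}_{C(X(t))}(-X''(t))=0.\tag{2}$$ Precisely, $(\theta,X,Z)$ is a solution of (1) if and only if, on $[0,\infty)$, $\theta(t)=t/2+\theta_0$, $Z=X+\theta X'$, and $X$ is differentiable with $X'$ locally absolutely continuous, $X(0)=x_0$, $X'(0)=(z_0-x_0)/\theta_0$, and (2) holds for almost every $t>0$. -/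

import Mathlib

open Set Filter Topology MeasureTheory
open scoped NNReal

namespace MultiObj

/-- The Euclidean space `ℝⁿ`. -/
abbrev E (n : ℕ) : Type := EuclideanSpace ℝ (Fin n)

/-- The metric projection of `x` onto `C`: the minimizer over `C` of `y ↦ ½‖y - x‖²`
(the value is `0` when there is no minimizer; for nonempty closed convex `C` there is exactly one,
see `proj_spec`). -/
noncomputable def proj {n : ℕ} (C : Set (E n)) (x : E n) : E n :=
  open Classical in
  if h : ∃ p ∈ C, IsMinOn (fun y => (1 / 2 : ℝ) * ‖y - x‖ ^ 2) C p then h.choose else 0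

/-- On a nonempty closed convex set, `proj C x` is the unique point of `C` that
minimizes the distance to `x`. -/
theorem proj_spec {n : ℕ} {C : Set (E n)} (hne : C.Nonempty) (hcl : IsClosed C)
    (hconv : Convex ℝ C) (x : E n) :
    (proj C x ∈ C ∧ ∀ y ∈ C, ‖proj C x - x‖ ≤ ‖y - x‖) ∧
      ∀ p ∈ C, (∀ y ∈ C, ‖p - x‖ ≤ ‖y - x‖) → p = proj C x := by
  have key : ∀ p ∈ C, (∀ y ∈ C, ‖p - x‖ ≤ ‖y - x‖) →
      ∀ w ∈ C, inner ℝ (x - p) (w - p) ≤ 0 := by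
    intro p hp h
    refine (norm_eq_iInf_iff_real_inner_le_zero hconv hp).1 ?_
    have : Nonempty C := ⟨⟨p, hp⟩⟩
    refine le_antisymm (le_ciInf fun w => ?_)
      (ciInf_le ⟨0, Set.forall_mem_range.2 fun _ => norm_nonneg _⟩ (⟨p, hp⟩ : C))
    rw [norm_sub_rev x p, norm_sub_rev x w]
    exact h w w.2
  have hex : ∃ p ∈ C, IsMinOn (fun y => (1 / 2 : ℝ) * ‖y - x‖ ^ 2) C p := by
    obtain ⟨p, hp, h⟩ := exists_norm_eq_iInf_of_complete_convex hne hcl.isComplete hconv x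
    refine ⟨p, hp, fun y hy => ?_⟩
    have h1 : ‖x - p‖ ≤ ‖x - y‖ := by
      rw [h]
      exact ciInf_le ⟨0, Set.forall_mem_range.2 fun _ => norm_nonneg _⟩ (⟨y, hy⟩ : C)
    rw [norm_sub_rev x p, norm_sub_rev x y] at h1
    have h2 := norm_nonneg (p - x)
    simp only [Set.mem_ofPred_eq]
    gcongr
  have hpm : proj C x ∈ C ∧ ∀ y ∈ C, ‖proj C x - x‖ ≤ ‖y - x‖ := by
    have e : proj C x = hex.choose := by simp only [proj, dif_pos hex]
    rw [e]
    refine ⟨hex.choose_spec.1, fun y hy => ?_⟩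
    have := hex.choose_spec.2 hy
    simp only [Set.mem_ofPred_eq] at this
    exact le_of_sq_le_sq (by linarith) (norm_nonneg _)
  refine ⟨hpm, fun p hp h => ?_⟩
  have a := key p hp h _ hpm.1
  have b := key _ hpm.1 hpm.2 p hp
  have c : inner ℝ (p - proj C x) (p - proj C x) ≤ (0 : ℝ) := by
    have e : inner ℝ (p - proj C x) (p - proj C x)
        = inner ℝ (x - p) (proj C x - p) + inner ℝ (x - proj C x) (p - proj C x) := by
      rw [← neg_sub p (proj C x), inner_neg_right, neg_add_eq_sub, ← inner_sub_left]
      congr 1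
      abel
    rw [e]; linarith
  rw [real_inner_self_nonpos] at c
  exact sub_eq_zero.1 c

/-- The convex hull `C(x)` of the gradients `∇f₁(x), …, ∇f_m(x)`. -/
noncomputable def gradHull {n m : ℕ} (f : Fin m → E n → ℝ) (x : E n) : Set (E n) :=
  convexHull ℝ (range fun j => gradient (f j) x)

/-- The class of `C¹` functions with `L`-Lipschitz gradient on `ℝⁿ`. -/
def IsSmoothClass {n : ℕ} (L : ℝ≥0) (f : E n → ℝ) : Prop :=
  ContDiff ℝ 1 f ∧ LipschitzWith L (gradient f)

/-- The model function of the accelerated proximal gradient step: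
`φ(w; x, y) = max_j [⟪∇f_j(y), w - y⟫ + f_j(y) - f_j(x)] + ‖w - y‖² / (2τ)`. -/
noncomputable def accModel {n m : ℕ} (f : Fin m → E n → ℝ) (τ : ℝ) (x y w : E n) : ℝ :=
  ⨆ j, ((inner ℝ (gradient (f j) y) (w - y) + f j y - f j x) + 1 / (2 * τ) * ‖w - y‖ ^ 2)

/-- The sequences `(θ_k)`, `(x_k)`, `(y_k)`, `(z_k)` of the accelerated proximal gradient method
with step size `τ`, initial parameter `θ_0 = a`, starting from `x0` with auxiliary point `z0`.
The method proper has `z0 = x0`, that is `y_0 = x_0`. -/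
structure IsAPG {n m : ℕ} (f : Fin m → E n → ℝ) (τ a : ℝ) (x0 z0 : E n)
    (th : ℕ → ℝ) (x y z : ℕ → E n) : Prop where
  th_zero : th 0 = a
  x_zero : x 0 = x0
  z_zero : z 0 = z0
  y_zero : y 0 = x 0 + th 0 • (z 0 - x 0)
  th_succ : ∀ k, (th (k + 1))⁻¹ = Real.sqrt ((th k)⁻¹ ^ 2 + 1 / 4) + 1 / 2
  x_succ : ∀ k, IsMinOn (accModel f τ (x k) (y k)) univ (x (k + 1))
  y_succ : ∀ k, y (k + 1) = x (k + 1) + (th (k + 1) * ((th k)⁻¹ - 1)) • (x (k + 1) - x k)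
  z_succ : ∀ k, z (k + 1) = x (k + 1) + ((th k)⁻¹ - 1) • (x (k + 1) - x k)

/-- `(θ, X, Z)` solves on `[0, ∞)` the first-order system
`[θ²]' = θ`, `θ X' = Z - X`, `Z' = -θ proj_{C(X)} ((3X' - 2Z') / (2θ))`
with `θ(0) = θ0`, `X(0) = x0`, `Z(0) = z0`. The first two equations hold for every `t ≥ 0`
(one-sided derivatives at `0`), the path `Z` is locally absolutely continuous and the third
equation holds for almost every `t > 0`. -/
structure IsFlow {n m : ℕ} (f : Fin m → E n → ℝ) (θ0 : ℝ) (x0 z0 : E n)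
    (θ : ℝ → ℝ) (X Z : ℝ → E n) : Prop where
  θ_zero : θ 0 = θ0
  X_zero : X 0 = x0
  Z_zero : Z 0 = z0
  θ_ode : ∀ t, 0 ≤ t → HasDerivWithinAt (fun s => θ s ^ 2) (θ t) (Ici 0) t
  X_ode : ∀ t, 0 ≤ t → ∃ X' : E n, HasDerivWithinAt X X' (Ici 0) t ∧ θ t • X' = Z t - X t
  Z_ac : ∀ T, 0 ≤ T → AbsolutelyContinuousOnInterval Z 0 T
  Z_ode : ∀ᵐ t : ℝ, 0 < t → ∃ X' Z' : E n, HasDerivAt X X' t ∧ HasDerivAt Z Z' t ∧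
    Z' = -(θ t • proj (gradHull f (X t)) ((2 * θ t)⁻¹ • ((3 : ℝ) • X' - (2 : ℝ) • Z')))

/-- `X` solves on `[0, ∞)` the second-order equation
`X'' + 3 / (t + 2 θ0) X' + proj_{C(X)} (-X'') = 0` with `X(0) = x0`, `X'(0) = v0`:
`X` is differentiable, `X'` is locally absolutely continuous and the equation holds for almost
every `t > 0`. -/
structure IsSecondOrderFlow {n m : ℕ} (f : Fin m → E n → ℝ) (θ0 : ℝ) (x0 v0 : E n)
    (X : ℝ → E n) : Prop where
  X_zero : X 0 = x0
  X_diff : DifferentiableOn ℝ X (Ici 0)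
  V_zero : derivWithin X (Ici 0) 0 = v0
  V_ac : ∀ T, 0 ≤ T → AbsolutelyContinuousOnInterval (derivWithin X (Ici 0)) 0 T
  ode : ∀ᵐ t : ℝ, 0 < t → ∃ X'' : E n, HasDerivAt (derivWithin X (Ici 0)) X'' t ∧
    X'' + (3 / (t + 2 * θ0)) • derivWithin X (Ici 0) t + proj (gradHull f (X t)) (-X'') = 0

/-- Convergence, uniformly on every `[0, T]`, of the discrete paths to `(θ, X, Z)` in the time
`t = √τ k`: the piecewise constant paths with the values `√τ / θ_k`, `x_k`, `z_k` on
`[√τ k, √τ (k + 1))` converge. -/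
def DiscreteTendsto {ι : Type*} {n : ℕ} (l : Filter ι) (τ : ι → ℝ) (th : ι → ℕ → ℝ)
    (x z : ι → ℕ → E n) (θ : ℝ → ℝ) (X Z : ℝ → E n) : Prop :=
  ∀ T : ℝ,
    TendstoUniformlyOn (fun i t => √(τ i) / th i ⌊t / √(τ i)⌋₊) θ l (Icc 0 T) ∧
    TendstoUniformlyOn (fun i t => x i ⌊t / √(τ i)⌋₊) X l (Icc 0 T) ∧
    TendstoUniformlyOn (fun i t => z i ⌊t / √(τ i)⌋₊) Z l (Icc 0 T)

end MultiObj

/-!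
Write `h = √τ`, `S_k = h / θ_k` and `ξ_k = (y_k - x_{k+1}) / τ`. The method satisfies
`y_k = x_k + θ_k (z_k - x_k)`, `x_{k+1} - x_k = θ_k (z_{k+1} - x_k)` and
`z_{k+1} - z_k = -h S_k ξ_k`, which is an Euler scheme with the step `h` for
`θ X' = Z - X`, `Z' = -θ ξ`; moreover `S_k = k h / 2 + θ0 + O(h)`
(`IsAPG.scaled_theta_bounds`).

The proximal step has a unique minimizer by coercivity and strong convexity. Its optimality
condition, `exists_active_inner_le`, says that no direction separates `ξ_k` from the gradients
`∇f_j(y_k)` of active indices `j`, and a Taylor estimate turns activity into the statement that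
`ξ_k` maximizes `⟪·, (x_{k+1} - x_k) / h⟫` over the gradients up to `O(h)`
(`inner_sub_le_inner_step`).

On the continuous side, `p = proj_C (p + v)` holds if and only if `p ∈ C` and `p` maximizes
`⟪v, ·⟫` over `C`. With `p = -Z' / θ` and `(3 X' - 2 Z') / (2 θ) = p + 3 X' / (2 θ)`, the third
equation of the system says that `-Z' / θ` is a maximizer of `⟪X', ·⟫` over `C(X)`. This is a
family of linear inequalities for `Z'` (`eq_neg_smul_proj_of_inner_le`), and it is the limit of
the inequalities for `ξ_k`. Linear inequalities for the increments of the discrete paths hold for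
averages of increments, hence for the difference quotients of a locally uniform limit
(`eventually_slope_mem`), so no weak compactness of the derivatives is needed.

The gradients grow at most linearly, so a discrete Grönwall estimate bounds the iterates and their
increments (`exists_apriori_bound`), and an Arzelà–Ascoli argument for asymptotically Lipschitz
paths (`exists_subseq_tendstoUniformlyOn`) gives convergent subsequences. The parameter `θ` of a
solution is explicit (`theta_eq_of_sq_hasDerivWithinAt`) and `Z = X + θ X'`, so if `X` is unique
then every subsequence has the same limit. Finally `Z' = θ X'' + (3 / 2) X'` translates the
first-order system into the second-order equation and back.
-/

namespace MultiObj

/-! ### The proximal subproblem -/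

section Step

variable {n m : ℕ} {f : Fin m → E n → ℝ} {τ : ℝ} {x y w : E n}

/-- The `j`-th function under the maximum in `accModel`. -/
noncomputable def accTerm (f : Fin m → E n → ℝ) (τ : ℝ) (x y : E n) (j : Fin m) (w : E n) : ℝ :=
  (inner ℝ (gradient (f j) y) (w - y) + f j y - f j x) + 1 / (2 * τ) * ‖w - y‖ ^ 2

lemma accTerm_le_accModel (j : Fin m) (w : E n) : accTerm f τ x y j w ≤ accModel f τ x y w :=
  le_ciSup (f := fun j => accTerm f τ x y j w) (Finite.bddAbove_range _) j

lemma exists_accTerm_eq_accModel [Nonempty (Fin m)] (w : E n) :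
    ∃ j, accTerm f τ x y j w = accModel f τ x y w :=
  exists_eq_ciSup_of_finite (f := fun j => accTerm f τ x y j w)

lemma accTerm_add_smul (j : Fin m) (w d : E n) (t : ℝ) :
    accTerm f τ x y j (w + t • d) = accTerm f τ x y j w +
      t * (inner ℝ (gradient (f j) y) d - inner ℝ (τ⁻¹ • (y - w)) d + t / (2 * τ) * ‖d‖ ^ 2) := by
  have e : w + t • d - y = (w - y) + t • d := by abel
  have e2 : y - w = -(w - y) := by abel
  simp only [accTerm]
  rw [e, e2, norm_add_sq_real, inner_add_right, inner_smul_right, inner_smul_right, norm_smul,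
    inner_smul_left, inner_neg_left, mul_pow, Real.norm_eq_abs, sq_abs]
  simp only [conj_trivial]
  have : 1 / (2 * τ) = τ⁻¹ / 2 := by rw [one_div, mul_inv]; ring
  rw [this, div_eq_mul_inv t, mul_inv]
  ring

lemma continuous_accTerm (j : Fin m) : Continuous (accTerm f τ x y j) := by
  unfold accTerm; fun_prop

lemma continuous_accModel [Nonempty (Fin m)] : Continuous (accModel f τ x y) := by
  have : accModel f τ x y = fun w => Finset.univ.sup' Finset.univ_nonempty
      (fun j => accTerm f τ x y j w) := by
    funext w
    rw [Finset.sup'_univ_eq_ciSup]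
    rfl
  rw [this]
  exact Continuous.finset_sup'_apply _ fun j _ => continuous_accTerm j

/-- The model function dominates a strongly convex quadratic, so it is coercive and has a
minimizer. -/
lemma exists_isMinOn_accModel [Nonempty (Fin m)] (hτ : 0 < τ) :
    ∃ w, IsMinOn (accModel f τ x y) univ w := by
  obtain ⟨j⟩ := ‹Nonempty (Fin m)›
  have : Nonempty (Fin m) := ⟨j⟩
  have hlim : Tendsto (accModel f τ x y) (cocompact (E n)) atTop := by
    set a := ‖gradient (f j) y‖
    have h0 : Tendsto (fun w : E n => ‖w - y‖) (cocompact (E n)) atTop :=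
      tendsto_norm_cocompact_atTop.comp (Homeomorph.subRight y).isClosedEmbedding.tendsto_cocompact
    have h1 : Tendsto (fun r : ℝ => r * (1 / (2 * τ) * r - a) + (f j y - f j x)) atTop atTop := by
      refine tendsto_atTop_add_const_right _ _ (tendsto_id.atTop_mul_atTop₀ ?_)
      exact tendsto_atTop_add_const_right _ _ (tendsto_id.const_mul_atTop (by positivity))
    refine tendsto_atTop_mono (fun w => ?_) (h1.comp h0)
    refine le_trans ?_ (accTerm_le_accModel j w)
    have := neg_le_of_abs_le (abs_real_inner_le_norm (gradient (f j) y) (w - y))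
    simp only [Function.comp, accTerm]
    linarith
  obtain ⟨w, hw⟩ := continuous_accModel.exists_forall_le hlim
  exact ⟨w, fun v _ => hw v⟩

/-- At the midpoint of two minimizers the quadratic term would be strictly smaller. -/
lemma isMinOn_accModel_unique [Nonempty (Fin m)] (hτ : 0 < τ) {v w : E n}
    (hv : IsMinOn (accModel f τ x y) univ v) (hw : IsMinOn (accModel f τ x y) univ w) : v = w := by
  set d := (2⁻¹ : ℝ) • (w - v)
  set p := v + (1 : ℝ) • d with hp
  have e1 : v = p + (-1 : ℝ) • d := by rw [hp]; module
  have e2 : w = p + (1 : ℝ) • d := by rw [hp]; module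
  obtain ⟨j, hj⟩ := exists_accTerm_eq_accModel (f := f) (τ := τ) (x := x) (y := y) p
  have a1 := accTerm_add_smul (f := f) (τ := τ) (x := x) (y := y) j p d (-1)
  have a2 := accTerm_add_smul (f := f) (τ := τ) (x := x) (y := y) j p d 1
  rw [← e1] at a1
  rw [← e2] at a2
  have b1 := accTerm_le_accModel (f := f) (τ := τ) (x := x) (y := y) j v
  have b2 := accTerm_le_accModel (f := f) (τ := τ) (x := x) (y := y) j w
  have c1 : accModel f τ x y v ≤ accModel f τ x y p := hv (mem_univ p)
  have c2 : accModel f τ x y w ≤ accModel f τ x y p := hw (mem_univ p)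
  have h : 1 / (2 * τ) * ‖d‖ ^ 2 ≤ 0 := by
    rw [neg_div] at a1
    linarith
  have hd : ‖d‖ ^ 2 ≤ 0 := by
    by_contra hcon
    have : 0 < 1 / (2 * τ) * ‖d‖ ^ 2 := mul_pos (by positivity) (not_le.1 hcon)
    linarith
  have hd0 : d = 0 := by
    rw [← norm_eq_zero]
    exact pow_eq_zero_iff two_ne_zero |>.1 (le_antisymm hd (by positivity))
  rw [hd0, smul_zero, add_zero] at e1 e2
  rw [e1, e2]

/-- First-order optimality, tested in the direction `d`: the scaled step `ξ = (y - w) / τ`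
satisfies `⟪ξ, d⟫ ≤ ⟪∇f_j(y), d⟫` for some index `j` that is active at the minimizer `w`. -/
lemma exists_active_inner_le [Nonempty (Fin m)] (hw : IsMinOn (accModel f τ x y) univ w)
    (d : E n) :
    ∃ j, (∀ i, inner ℝ (gradient (f i) y) (w - y) + f i y - f i x ≤
        inner ℝ (gradient (f j) y) (w - y) + f j y - f j x) ∧
      inner ℝ (τ⁻¹ • (y - w)) d ≤ inner ℝ (gradient (f j) y) d := by
  by_contra! hcon
  -- along `w + t d`, every term stays strictly below the minimum for small `t > 0`
  have key : ∀ j, ∀ᶠ t in 𝓝[>] (0 : ℝ), accTerm f τ x y j (w + t • d) < accModel f τ x y w := by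
    intro j
    by_cases hj : accTerm f τ x y j w = accModel f τ x y w
    · have hlt := hcon j fun i => by
        have := accTerm_le_accModel (f := f) (τ := τ) (x := x) (y := y) i w
        rw [← hj] at this
        simpa [accTerm] using this
      have hlim : Tendsto (fun t : ℝ => inner ℝ (gradient (f j) y) d -
          inner ℝ (τ⁻¹ • (y - w)) d + t / (2 * τ) * ‖d‖ ^ 2) (𝓝[>] 0)
          (𝓝 (inner ℝ (gradient (f j) y) d - inner ℝ (τ⁻¹ • (y - w)) d +
            0 / (2 * τ) * ‖d‖ ^ 2)) :=
        (Continuous.tendsto (by fun_prop) 0).mono_left nhdsWithin_le_nhds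
      filter_upwards [hlim.eventually_lt_const (u := 0) (by simpa using hlt),
        self_mem_nhdsWithin] with t ht ht0
      rw [accTerm_add_smul, hj]
      have := mul_neg_of_pos_of_neg (mem_Ioi.1 ht0) ht
      linarith
    · have hlt := lt_of_le_of_ne (accTerm_le_accModel j w) hj
      have hlim : Tendsto (fun t : ℝ => accTerm f τ x y j (w + t • d)) (𝓝[>] 0)
          (𝓝 (accTerm f τ x y j (w + (0 : ℝ) • d))) :=
        (Continuous.tendsto ((continuous_accTerm j).comp (by fun_prop)) 0).mono_left
          nhdsWithin_le_nhds
      exact hlim.eventually_lt_const (by simpa using hlt)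
  obtain ⟨t, ht⟩ := (eventually_all.2 key).exists
  obtain ⟨j, hj⟩ := exists_accTerm_eq_accModel (f := f) (τ := τ) (x := x) (y := y) (w + t • d)
  have h1 : accModel f τ x y w ≤ accModel f τ x y (w + t • d) := hw (mem_univ _)
  linarith [ht j]

/-- The scaled step is bounded by the gradients at the extrapolated point. -/
lemma norm_step_le [Nonempty (Fin m)] (hw : IsMinOn (accModel f τ x y) univ w) :
    ‖τ⁻¹ • (y - w)‖ ≤ ∑ j, ‖gradient (f j) y‖ := by
  obtain ⟨j, -, hj⟩ := exists_active_inner_le hw (τ⁻¹ • (y - w))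
  set ξ := τ⁻¹ • (y - w)
  have h1 : ‖ξ‖ * ‖ξ‖ ≤ ‖gradient (f j) y‖ * ‖ξ‖ := by
    rw [← real_inner_self_eq_norm_mul_norm]
    exact hj.trans (real_inner_le_norm _ _)
  have h2 : ‖gradient (f j) y‖ ≤ ∑ j, ‖gradient (f j) y‖ :=
    Finset.single_le_sum (f := fun j => ‖gradient (f j) y‖) (fun _ _ => norm_nonneg _)
      (Finset.mem_univ j)
  rcases (norm_nonneg ξ).eq_or_lt with h | h
  · rw [← h]; exact Finset.sum_nonneg fun _ _ => norm_nonneg _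
  · exact (le_of_mul_le_mul_right h1 h).trans h2

/-- First-order Taylor estimate for a function with Lipschitz gradient. -/
lemma IsSmoothClass.abs_sub_sub_inner_le {L : ℝ≥0} {g : E n → ℝ} (hg : IsSmoothClass L g)
    (x y : E n) : |g y - g x - inner ℝ (gradient g y) (y - x)| ≤ L * ‖y - x‖ ^ 2 := by
  have hd : ∀ z, HasFDerivAt g (InnerProductSpace.toDual ℝ (E n) (gradient g z)) z := fun z =>
    ((hg.1.differentiable one_ne_zero) z).hasGradientAt.hasFDerivAt
  have := (convex_segment x y).norm_image_sub_le_of_norm_hasFDerivWithin_le' (f := g)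
    (f' := fun z => InnerProductSpace.toDual ℝ (E n) (gradient g z))
    (φ := InnerProductSpace.toDual ℝ (E n) (gradient g y)) (C := L * ‖y - x‖)
    (fun z _ => (hd z).hasFDerivWithinAt) (fun z hz => ?_) (left_mem_segment ℝ x y)
    (right_mem_segment ℝ x y)
  · rw [InnerProductSpace.toDual_apply_apply, Real.norm_eq_abs] at this
    calc _ ≤ L * ‖y - x‖ * ‖y - x‖ := this
      _ = _ := by ring
  · rw [← map_sub, LinearIsometryEquiv.norm_map]
    refine (hg.2.norm_sub_le z y).trans ?_
    gcongr
    rw [norm_sub_rev y x]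
    obtain ⟨a, b, ha, hb, hab, rfl⟩ := hz
    have e : a • x + b • y - y = a • (x - y) := by
      have : b = 1 - a := by linarith
      rw [this]; module
    rw [e, norm_smul, Real.norm_of_nonneg ha]
    exact mul_le_of_le_one_left (norm_nonneg _) (by linarith)

/-- The scaled step nearly maximizes `⟪·, w - x⟫` over the gradients at `y`, up to an error that is
quadratic in `y - x`. -/
lemma inner_sub_le_inner_step [Nonempty (Fin m)] {L : Fin m → ℝ≥0}
    (hf : ∀ j, IsSmoothClass (L j) (f j)) (hw : IsMinOn (accModel f τ x y) univ w) (i : Fin m) :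
    inner ℝ (gradient (f i) y) (w - x) - 2 * (∑ j, (L j : ℝ)) * ‖y - x‖ ^ 2 ≤
      inner ℝ (τ⁻¹ • (y - w)) (w - x) := by
  obtain ⟨j, hact, hj⟩ := exists_active_inner_le hw (-(w - x))
  rw [inner_neg_right, inner_neg_right, neg_le_neg_iff] at hj
  have hL : ∀ j, (L j : ℝ) * ‖y - x‖ ^ 2 ≤ (∑ j, (L j : ℝ)) * ‖y - x‖ ^ 2 := fun j => by
    gcongr
    exact Finset.single_le_sum (f := fun j => (L j : ℝ)) (fun _ _ => (L _).2) (Finset.mem_univ j)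
  have h1 := abs_le.1 ((hf j).abs_sub_sub_inner_le x y)
  have h2 := abs_le.1 ((hf i).abs_sub_sub_inner_le x y)
  have h3 := hact i
  have e : ∀ g : E n, inner ℝ g (w - x) = inner ℝ g (w - y) + inner ℝ g (y - x) := fun g => by
    rw [← inner_add_right]; congr 1; abel
  rw [e] at hj ⊢
  have := hL i
  have := hL j
  linarith [h1.1, h1.2, h2.1, h2.2]

end Step

/-! ### Well-posedness of the method -/

section Method

variable {n m : ℕ} {f : Fin m → E n → ℝ} {τ a : ℝ} {x0 z0 : E n}

/-- The state `(θ_k, x_k, y_k, z_k)` of the method, with the proximal step chosen by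
`Classical.epsilon`. -/
noncomputable def apgState (f : Fin m → E n → ℝ) (τ a : ℝ) (x0 z0 : E n) :
    ℕ → ℝ × E n × E n × E n
  | 0 => (a, x0, x0 + a • (z0 - x0), z0)
  | k + 1 =>
    let s := apgState f τ a x0 z0 k
    let t := (Real.sqrt (s.1⁻¹ ^ 2 + 1 / 4) + 1 / 2)⁻¹
    let w := Classical.epsilon fun w => IsMinOn (accModel f τ s.2.1 s.2.2.1) univ w
    (t, w, w + (t * (s.1⁻¹ - 1)) • (w - s.2.1), w + (s.1⁻¹ - 1) • (w - s.2.1))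

lemma isAPG_apgState [Nonempty (Fin m)] (hτ : 0 < τ) :
    IsAPG f τ a x0 z0 (fun k => (apgState f τ a x0 z0 k).1)
      (fun k => (apgState f τ a x0 z0 k).2.1) (fun k => (apgState f τ a x0 z0 k).2.2.1)
      (fun k => (apgState f τ a x0 z0 k).2.2.2) where
  th_zero := rfl
  x_zero := rfl
  z_zero := rfl
  y_zero := rfl
  th_succ _ := inv_inv _
  x_succ _ := Classical.epsilon_spec (exists_isMinOn_accModel hτ)
  y_succ _ := rfl
  z_succ _ := rfl

lemma IsAPG.unique [Nonempty (Fin m)] (hτ : 0 < τ) {th th' : ℕ → ℝ} {x x' y y' z z' : ℕ → E n}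
    (h : IsAPG f τ a x0 z0 th x y z) (h' : IsAPG f τ a x0 z0 th' x' y' z') :
    th = th' ∧ x = x' ∧ y = y' ∧ z = z' := by
  have key : ∀ k, th k = th' k ∧ x k = x' k ∧ y k = y' k ∧ z k = z' k := by
    intro k
    induction k with
    | zero =>
      rw [h.y_zero, h'.y_zero, h.th_zero, h'.th_zero, h.x_zero, h'.x_zero, h.z_zero, h'.z_zero]
      simp
    | succ k ih =>
      obtain ⟨i1, i2, i3, i4⟩ := ih
      have e1 : th (k + 1) = th' (k + 1) := by
        rw [← inv_inj, h.th_succ, h'.th_succ, i1]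
      have e2 : x (k + 1) = x' (k + 1) := by
        have := h.x_succ k
        rw [i2, i3] at this
        exact isMinOn_accModel_unique hτ this (h'.x_succ k)
      rw [h.y_succ, h'.y_succ, h.z_succ, h'.z_succ, e1, e2, i1, i2]
      simp
  exact ⟨funext fun k => (key k).1, funext fun k => (key k).2.1, funext fun k => (key k).2.2.1,
    funext fun k => (key k).2.2.2⟩

lemma existsUnique_isAPG [Nonempty (Fin m)] (f : Fin m → E n → ℝ) (hτ : 0 < τ) (a : ℝ)
    (x0 z0 : E n) :
    ∃! s : (ℕ → ℝ) × (ℕ → E n) × (ℕ → E n) × (ℕ → E n),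
      IsAPG f τ a x0 z0 s.1 s.2.1 s.2.2.1 s.2.2.2 := by
  refine ⟨⟨_, _, _, _⟩, isAPG_apgState hτ, ?_⟩
  rintro ⟨th, x, y, z⟩ h
  obtain ⟨rfl, rfl, rfl, rfl⟩ := IsAPG.unique hτ h (isAPG_apgState hτ)
  rfl

end Method

/-! ### A priori estimates for the method -/

section Estimates

variable {n m : ℕ} {f : Fin m → E n → ℝ} {τ a θ0 : ℝ} {x0 z0 : E n}
  {th : ℕ → ℝ} {x y z : ℕ → E n}

lemma IsAPG.th_pos (h : IsAPG f τ a x0 z0 th x y z) (ha : 0 < a) (k : ℕ) : 0 < th k := by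
  cases k with
  | zero => rwa [h.th_zero]
  | succ k =>
    rw [← inv_pos, h.th_succ]
    positivity

lemma IsAPG.inv_th_succ_bounds (h : IsAPG f τ a x0 z0 th x y z) (ha : 0 < a) (k : ℕ) :
    (th k)⁻¹ + 1 / 2 ≤ (th (k + 1))⁻¹ ∧ (th (k + 1))⁻¹ ≤ (th k)⁻¹ + 1 / 2 + th k / 8 := by
  have h0 := h.th_pos ha k
  have h1 : 0 < (th k)⁻¹ := inv_pos.2 h0
  rw [h.th_succ]
  constructor
  · have : (th k)⁻¹ ≤ √((th k)⁻¹ ^ 2 + 1 / 4) := Real.le_sqrt_of_sq_le (by linarith)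
    linarith
  · have : √((th k)⁻¹ ^ 2 + 1 / 4) ≤ (th k)⁻¹ + th k / 8 := by
      refine Real.sqrt_le_iff.2 ⟨by positivity, ?_⟩
      have e : (th k)⁻¹ * th k = 1 := inv_mul_cancel₀ h0.ne'
      nlinarith [sq_nonneg (th k)]
    linarith

/-- In the time `t = √τ k` the parameter `√τ / θ_k` follows `t / 2 + θ0` up to `O(√τ)`. -/
lemma IsAPG.scaled_theta_bounds (h : IsAPG f τ (√τ / θ0) x0 z0 th x y z) (hτ : 0 < τ)
    (hθ0 : 0 < θ0) (k : ℕ) :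
    k * √τ / 2 + θ0 ≤ √τ / th k ∧ √τ / th k ≤ k * √τ / 2 + θ0 + k * √τ * √τ / (8 * θ0) := by
  have hs : 0 < √τ := Real.sqrt_pos.2 hτ
  have ha : 0 < √τ / θ0 := by positivity
  induction k with
  | zero =>
    rw [h.th_zero, div_div_cancel₀ hs.ne']
    simp
  | succ k ih =>
    obtain ⟨b1, b2⟩ := h.inv_th_succ_bounds ha k
    have hp := h.th_pos ha k
    have hle : √τ * th k ≤ √τ * √τ / θ0 := by
      have h1 : θ0 ≤ √τ / th k := le_trans (by simp; positivity) ih.1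
      rw [le_div_iff₀ hp] at h1
      rw [le_div_iff₀ hθ0]
      nlinarith
    have e8 : √τ * √τ / (8 * θ0) = √τ * √τ / θ0 / 8 := by field_simp
    have e8' : k * √τ * √τ / (8 * θ0) = k * (√τ * √τ / (8 * θ0)) := by ring
    have e8'' : ((k + 1 : ℕ) : ℝ) * √τ * √τ / (8 * θ0) = (k + 1) * (√τ * √τ / (8 * θ0)) := by
      push_cast; ring
    rw [div_eq_mul_inv √τ (th k), e8', e8] at ih
    rw [div_eq_mul_inv √τ (th (k + 1)), e8'', e8]
    obtain ⟨i1, i2⟩ := ih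
    push_cast
    constructor
    · nlinarith [mul_le_mul_of_nonneg_left b1 hs.le]
    · nlinarith [mul_le_mul_of_nonneg_left b2 hs.le]

lemma IsAPG.y_eq (h : IsAPG f τ a x0 z0 th x y z) (k : ℕ) :
    y k = x k + th k • (z k - x k) := by
  cases k with
  | zero => exact h.y_zero
  | succ k => rw [h.y_succ, h.z_succ, add_sub_cancel_left, smul_smul]

lemma IsAPG.x_step (h : IsAPG f τ a x0 z0 th x y z) (ha : 0 < a) (k : ℕ) :
    x (k + 1) - x k = th k • (z (k + 1) - x k) := by
  have h0 := (h.th_pos ha k).ne'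
  have : z (k + 1) - x k = (th k)⁻¹ • (x (k + 1) - x k) := by
    rw [h.z_succ, sub_smul]; module
  rw [this, smul_inv_smul₀ h0]

lemma IsAPG.z_step (h : IsAPG f τ a x0 z0 th x y z) (ha : 0 < a) (hτ : 0 < τ) (k : ℕ) :
    z (k + 1) - z k = -(√τ * (√τ / th k)) • (τ⁻¹ • (y k - x (k + 1))) := by
  have h0 := (h.th_pos ha k).ne'
  have e : y k - x (k + 1) = th k • (z k - z (k + 1)) := by
    have h1 := h.x_step ha k
    rw [sub_eq_iff_eq_add] at h1
    rw [h1, h.y_eq k]; module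
  have e2 : √τ * (√τ / th k) = τ * (th k)⁻¹ := by
    rw [div_eq_mul_inv, ← mul_assoc, Real.mul_self_sqrt hτ.le]
  rw [e, smul_smul, smul_smul, e2]
  have : -(τ * (th k)⁻¹) * τ⁻¹ * th k = -1 := by field_simp
  rw [this]
  module

/-- For small step sizes the iterates up to the time `T` are bounded and move by `O(√τ)` per step:
a discrete Grönwall estimate for `max ‖x_k‖ ‖z_k‖`, as the gradients grow at most linearly. -/
lemma exists_apriori_bound [Nonempty (Fin m)] {L : Fin m → ℝ≥0}
    (hf : ∀ j, IsSmoothClass (L j) (f j)) (hθ0 : 0 < θ0) (x0 z0 : E n) {T : ℝ} (hT : 0 ≤ T) :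
    ∃ C : ℝ, 0 ≤ C ∧ ∃ h0 : ℝ, 0 < h0 ∧
      ∀ (τ : ℝ) (th : ℕ → ℝ) (x y z : ℕ → E n), 0 < τ → √τ ≤ h0 →
      IsAPG f τ (√τ / θ0) x0 z0 th x y z → ∀ k : ℕ, k * √τ ≤ T →
        ‖x k‖ ≤ C ∧ ‖z k‖ ≤ C ∧ ‖x (k + 1) - x k‖ ≤ C * √τ ∧ ‖z (k + 1) - z k‖ ≤ C * √τ := by
  set A := ∑ j, ‖gradient (f j) 0‖ with hA
  set B := ∑ j, (L j : ℝ) with hB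
  have hA0 : 0 ≤ A := Finset.sum_nonneg fun _ _ => norm_nonneg _
  have hB0 : 0 ≤ B := Finset.sum_nonneg fun _ _ => (L _).2
  have hgrad : ∀ v : E n, ∑ j, ‖gradient (f j) v‖ ≤ A + B * ‖v‖ := by
    intro v
    rw [hA, hB, Finset.sum_mul, ← Finset.sum_add_distrib]
    refine Finset.sum_le_sum fun j _ => ?_
    have h1 := (hf j).2.norm_sub_le v 0
    rw [sub_zero] at h1
    have h2 := norm_sub_norm_le (gradient (f j) v) (gradient (f j) 0)
    linarith
  set Θ := T / 2 + θ0 + T / (8 * θ0) with hΘ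
  have hΘ0 : 0 ≤ Θ := by positivity
  set K := Θ * (A + B) with hK
  have hK0 : 0 ≤ K := by positivity
  set R := (1 + max ‖x0‖ ‖z0‖) * Real.exp (K * T) with hR
  have hR0 : 0 ≤ R := by positivity
  -- `√τ ≤ θ0` makes `θ_k ≤ 1`, so that `y_k` and `x_{k+1}` are convex combinations
  refine ⟨R + K * R + θ0⁻¹ * (K * R + R + R), by positivity, min 1 θ0, lt_min one_pos hθ0, ?_⟩
  intro τ th x y z hτ hτ0 h
  have hs : 0 < √τ := Real.sqrt_pos.2 hτ
  have ha : 0 < √τ / θ0 := by positivity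
  have hs1 : √τ ≤ 1 := hτ0.trans (min_le_left _ _)
  have hsθ : √τ ≤ θ0 := hτ0.trans (min_le_right _ _)
  have hth : ∀ k, th k ≤ √τ / θ0 := by
    intro k
    have h1 : θ0 ≤ √τ / th k := le_trans (by simp; positivity) (h.scaled_theta_bounds hτ hθ0 k).1
    rw [le_div_iff₀ (h.th_pos ha k)] at h1
    rw [le_div_iff₀ hθ0]
    linarith
  have hth1 : ∀ k, th k ≤ 1 := fun k => (hth k).trans ((div_le_one hθ0).2 hsθ)
  have hS : ∀ k : ℕ, k * √τ ≤ T → √τ / th k ≤ Θ := by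
    intro k hk
    refine (h.scaled_theta_bounds hτ hθ0 k).2.trans ?_
    have h1 : k * √τ * √τ ≤ T := by
      have : 0 ≤ k * √τ := by positivity
      nlinarith
    have h2 : k * √τ * √τ / (8 * θ0) ≤ T / (8 * θ0) := by gcongr
    linarith
  have hcomb : ∀ k (p : E n), ‖x k + th k • (p - x k)‖ ≤ max ‖x k‖ ‖p‖ := by
    intro k p
    have e : x k + th k • (p - x k) = (1 - th k) • x k + th k • p := by module
    have hp := h.th_pos ha k
    rw [e]
    refine (norm_add_le _ _).trans ?_
    rw [norm_smul, norm_smul, Real.norm_of_nonneg hp.le,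
      Real.norm_of_nonneg (sub_nonneg.2 (hth1 k))]
    nlinarith [le_max_left ‖x k‖ ‖p‖, le_max_right ‖x k‖ ‖p‖, hth1 k]
  have hzstep : ∀ k : ℕ, k * √τ ≤ T →
      ‖z (k + 1) - z k‖ ≤ √τ * K * (1 + max ‖x k‖ ‖z k‖) := by
    intro k hk
    have hp := h.th_pos ha k
    rw [h.z_step ha hτ, norm_smul, norm_neg, Real.norm_of_nonneg (by positivity)]
    have h1 : ‖τ⁻¹ • (y k - x (k + 1))‖ ≤ (A + B) * (1 + max ‖x k‖ ‖z k‖) := by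
      refine (norm_step_le (h.x_succ k)).trans ((hgrad _).trans ?_)
      have h2 : ‖y k‖ ≤ max ‖x k‖ ‖z k‖ := by rw [h.y_eq]; exact hcomb k _
      have h3 : 0 ≤ max ‖x k‖ ‖z k‖ := (norm_nonneg _).trans (le_max_left _ _)
      nlinarith [mul_le_mul_of_nonneg_left h2 hB0, mul_nonneg hA0 h3]
    calc √τ * (√τ / th k) * ‖τ⁻¹ • (y k - x (k + 1))‖
        ≤ √τ * Θ * ((A + B) * (1 + max ‖x k‖ ‖z k‖)) := by
          gcongr
          exact hS k hk
      _ = _ := by rw [hK]; ring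
  -- `K` bounds both coefficients of the linear growth, hence the recursion for `1 + max ‖x_k‖ ‖z_k‖`
  have hgron : ∀ k : ℕ, k * √τ ≤ T →
      1 + max ‖x k‖ ‖z k‖ ≤ (1 + max ‖x0‖ ‖z0‖) * Real.exp (K * (k * √τ)) := by
    intro k
    induction k with
    | zero => intro _; simp [h.x_zero, h.z_zero]
    | succ k ih =>
      intro hk
      push_cast at hk
      have hk' : k * √τ ≤ T := by nlinarith
      have i1 := ih hk'
      have i2 := hzstep k hk'
      have h3 : 0 ≤ max ‖x k‖ ‖z k‖ := (norm_nonneg _).trans (le_max_left _ _)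
      have hz : ‖z (k + 1)‖ ≤ max ‖x k‖ ‖z k‖ + √τ * K * (1 + max ‖x k‖ ‖z k‖) := by
        have := norm_sub_norm_le (z (k + 1)) (z k)
        linarith [le_max_right ‖x k‖ ‖z k‖]
      have hx : ‖x (k + 1)‖ ≤ max ‖x k‖ ‖z k‖ + √τ * K * (1 + max ‖x k‖ ‖z k‖) := by
        have e := h.x_step ha k
        rw [sub_eq_iff_eq_add, add_comm _ (x k)] at e
        rw [e]
        refine (hcomb k _).trans (max_le ?_ hz)
        have : 0 ≤ √τ * K * (1 + max ‖x k‖ ‖z k‖) := by positivity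
        linarith [le_max_left ‖x k‖ ‖z k‖]
      calc 1 + max ‖x (k + 1)‖ ‖z (k + 1)‖
          ≤ (1 + max ‖x k‖ ‖z k‖) * (K * √τ + 1) := by
            have := max_le hx hz
            nlinarith
        _ ≤ ((1 + max ‖x0‖ ‖z0‖) * Real.exp (K * (k * √τ))) * Real.exp (K * √τ) := by
            gcongr
            exact Real.add_one_le_exp _
        _ = _ := by
            rw [mul_assoc, ← Real.exp_add]
            push_cast
            congr 2
            ring
  intro k hk
  have hM : 1 + max ‖x k‖ ‖z k‖ ≤ R := by
    refine (hgron k hk).trans ?_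
    rw [hR]
    gcongr
  have hxR : ‖x k‖ ≤ R := by linarith [le_max_left ‖x k‖ ‖z k‖]
  have hzR : ‖z k‖ ≤ R := by linarith [le_max_right ‖x k‖ ‖z k‖]
  have hz1 : ‖z (k + 1) - z k‖ ≤ K * R * √τ := by
    refine (hzstep k hk).trans ?_
    calc √τ * K * (1 + max ‖x k‖ ‖z k‖) ≤ √τ * K * R := by gcongr
      _ = _ := by ring
  have hx1 : ‖x (k + 1) - x k‖ ≤ θ0⁻¹ * (K * R + R + R) * √τ := by
    rw [h.x_step ha, norm_smul, Real.norm_of_nonneg (h.th_pos ha k).le]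
    have h4 : ‖z (k + 1) - x k‖ ≤ K * R + R + R := by
      have e : z (k + 1) - x k = (z (k + 1) - z k) + z k - x k := by abel
      rw [e]
      refine (norm_sub_le _ _).trans (add_le_add ((norm_add_le _ _).trans (add_le_add ?_ hzR)) hxR)
      refine hz1.trans ?_
      exact mul_le_of_le_one_right (by positivity) hs1
    calc th k * ‖z (k + 1) - x k‖ ≤ √τ / θ0 * (K * R + R + R) := by
          gcongr
          exact hth k
      _ = _ := by ring
  have p1 : 0 ≤ K * R := by positivity
  have p2 : 0 ≤ θ0⁻¹ * (K * R + R + R) := by positivity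
  refine ⟨by linarith, by linarith, hx1.trans ?_, hz1.trans ?_⟩
  · gcongr; linarith
  · gcongr; linarith

end Estimates

/-! ### Compactness for asymptotically equi-Lipschitz paths -/

/-- A sequence of paths that is locally bounded and locally equi-Lipschitz up to an error `ε i → 0`
has a subsequence that converges locally uniformly on `[0, ∞)`. The paths need not be continuous,
so this is the proof of the Arzelà–Ascoli theorem with a diagonal sequence over the rational
times. -/
lemma exists_subseq_tendstoUniformlyOn {F : Type*} [NormedAddCommGroup F] [ProperSpace F]
    (G : ℕ → ℝ → F) (ε : ℕ → ℝ) (hε : Tendsto ε atTop (𝓝 0))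
    (hG : ∀ T : ℝ, 0 ≤ T → ∃ C : ℝ, 0 ≤ C ∧ ∀ᶠ i in atTop, ∀ t ∈ Icc 0 T, ‖G i t‖ ≤ C ∧
      ∀ s ∈ Icc 0 T, ‖G i t - G i s‖ ≤ C * (|t - s| + ε i)) :
    ∃ φ : ℕ → ℕ, StrictMono φ ∧ ∃ g : ℝ → F, ∀ T : ℝ,
      TendstoUniformlyOn (fun i => G (φ i)) g atTop (Icc 0 T) := by
  have hR : ∀ q : ℚ, ∃ R : ℝ, ∀ i, ‖G i |(q : ℝ)|‖ ≤ R := by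
    intro q
    obtain ⟨C, hC, hev⟩ := hG |(q : ℝ)| (abs_nonneg _)
    obtain ⟨N, hN⟩ := eventually_atTop.1 hev
    have hS : 0 ≤ ∑ i ∈ Finset.range N, ‖G i |(q : ℝ)|‖ :=
      Finset.sum_nonneg fun _ _ => norm_nonneg _
    refine ⟨C + ∑ i ∈ Finset.range N, ‖G i |(q : ℝ)|‖, fun i => ?_⟩
    rcases le_or_gt N i with h | h
    · have := (hN i h |(q : ℝ)| ⟨abs_nonneg _, le_rfl⟩).1
      linarith
    · have := Finset.single_le_sum (f := fun i => ‖G i |(q : ℝ)|‖) (fun _ _ => norm_nonneg _)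
        (Finset.mem_range.2 h)
      linarith
  choose R hR using hR
  have hK : IsCompact (Set.pi univ fun q : ℚ => Metric.closedBall (0 : F) (R q)) :=
    isCompact_univ_pi fun q => isCompact_closedBall 0 (R q)
  obtain ⟨l, -, φ, hφ, hl⟩ := hK.tendsto_subseq (x := fun i (q : ℚ) => G i |(q : ℝ)|)
    fun i q _ => by simpa using hR q i
  rw [tendsto_pi_nhds] at hl
  have hcauchy : ∀ T : ℝ, 0 ≤ T → UniformCauchySeqOn (fun i => G (φ i)) atTop (Icc 0 T) := by
    intro T hT
    obtain ⟨C, hC, hev⟩ := hG T hT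
    rw [Metric.uniformCauchySeqOn_iff]
    intro e he
    -- the mesh `1 / (M + 1)` and the error `ε i` make each comparison with the grid cost `< e / 4`
    obtain ⟨M, hM⟩ := exists_nat_gt (8 * C / e)
    have hM1 : (0 : ℝ) < M + 1 := by positivity
    have hmesh : C * (1 / (M + 1)) < e / 8 := by
      rw [div_lt_iff₀ he] at hM
      rw [mul_one_div, div_lt_iff₀ hM1]
      nlinarith
    have hεφ : Tendsto (fun i => C * ε (φ i)) atTop (𝓝 0) := by
      simpa using (hε.comp hφ.tendsto_atTop).const_mul C
    have e1 := hεφ.eventually_lt_const (show (0 : ℝ) < e / 8 by positivity)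
    have e2 : ∀ᶠ i in atTop, ∀ k ∈ Finset.range (⌊T * (M + 1)⌋₊ + 1),
        dist (G (φ i) |(((k : ℚ) / (M + 1) : ℚ) : ℝ)|) (l ((k : ℚ) / (M + 1))) < e / 4 := by
      rw [Filter.eventually_all_finset]
      intro k _
      exact Metric.tendsto_nhds.1 (hl ((k : ℚ) / (M + 1))) _ (by positivity)
    have key : ∀ᶠ i in atTop, ∀ t ∈ Icc 0 T,
        dist (G (φ i) t) (l ((⌊t * (M + 1)⌋₊ : ℚ) / (M + 1))) < e / 2 := by
      filter_upwards [hφ.tendsto_atTop.eventually hev, e1, e2] with i h0 h1 h2 t ht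
      have hfl : (⌊t * (M + 1)⌋₊ : ℝ) ≤ t * (M + 1) :=
        Nat.floor_le (mul_nonneg ht.1 hM1.le)
      have hfl' := Nat.lt_floor_add_one (t * (M + 1))
      set k := ⌊t * (M + 1)⌋₊ with hk
      have hq0 : (0 : ℝ) ≤ k / (M + 1) := by positivity
      have hq : |(((k : ℚ) / (M + 1) : ℚ) : ℝ)| = k / (M + 1) := by
        push_cast
        exact abs_of_nonneg hq0
      have hqt : (k : ℝ) / (M + 1) ≤ t := by rwa [div_le_iff₀ hM1]
      have hqt' : |t - k / (M + 1)| ≤ 1 / (M + 1) := by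
        rw [abs_of_nonneg (by linarith), sub_le_iff_le_add, ← add_div, le_div_iff₀ hM1]
        linarith
      have hkr : k ∈ Finset.range (⌊T * (M + 1)⌋₊ + 1) := by
        rw [Finset.mem_range, Nat.lt_succ_iff]
        exact Nat.floor_mono (mul_le_mul_of_nonneg_right ht.2 hM1.le)
      have h3 := h2 k hkr
      rw [hq] at h3
      have h4 := (h0 t ht).2 (k / (M + 1)) ⟨hq0, hqt.trans ht.2⟩
      rw [← dist_eq_norm] at h4
      have h5 : C * |t - k / (M + 1)| ≤ C * (1 / (M + 1)) := by gcongr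
      refine (dist_triangle _ (G (φ i) (k / (M + 1))) _).trans_lt ?_
      linarith
    obtain ⟨N, hN⟩ := eventually_atTop.1 key
    refine ⟨N, fun i hi j hj t ht => ?_⟩
    refine (dist_triangle_right _ _ (l ((⌊t * (M + 1)⌋₊ : ℚ) / (M + 1)))).trans_lt ?_
    linarith [hN i hi t ht, hN j hj t ht]
  have hlim : ∀ t : ℝ, ∃ v, 0 ≤ t → Tendsto (fun i => G (φ i) t) atTop (𝓝 v) := by
    intro t
    by_cases ht : 0 ≤ t
    · obtain ⟨v, hv⟩ := cauchySeq_tendsto_of_complete ((hcauchy t ht).cauchySeq ⟨ht, le_rfl⟩)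
      exact ⟨v, fun _ => hv⟩
    · exact ⟨0, fun h => absurd h ht⟩
  choose g hg using hlim
  refine ⟨φ, hφ, g, fun T => ?_⟩
  rcases le_or_gt 0 T with hT | hT
  · exact (hcauchy T hT).tendstoUniformlyOn_of_tendsto fun t ht => hg t ht.1
  · rw [Icc_eq_empty (not_le.2 hT)]
    exact tendstoUniformlyOn_empty

/-! ### Differential properties of limits of piecewise constant paths -/

section Paths

variable {F : Type*} [NormedAddCommGroup F]

/-- A sequence that moves by at most `C h` per step gives a piecewise constant path that is
Lipschitz up to an error `C h`. -/
lemma norm_path_sub_le {a : ℕ → F} {C h T : ℝ} (hC : 0 ≤ C) (hh : 0 < h)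
    (ha : ∀ k : ℕ, k * h ≤ T → ‖a (k + 1) - a k‖ ≤ C * h) {s t : ℝ} (hs : s ∈ Icc 0 T)
    (ht : t ∈ Icc 0 T) : ‖a ⌊t / h⌋₊ - a ⌊s / h⌋₊‖ ≤ C * (|t - s| + h) := by
  wlog hst : s ≤ t generalizing s t
  · rw [norm_sub_rev, abs_sub_comm]
    exact this ht hs (not_le.1 hst).le
  have hk : ⌊s / h⌋₊ ≤ ⌊t / h⌋₊ := Nat.floor_mono (by gcongr)
  have hsum : ∀ l : ℕ, ⌊s / h⌋₊ + l ≤ ⌊t / h⌋₊ →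
      ‖a (⌊s / h⌋₊ + l) - a ⌊s / h⌋₊‖ ≤ l * (C * h) := by
    intro l
    induction l with
    | zero => simp
    | succ l ih =>
      intro hl
      have h1 := ih (by omega)
      have h2 : ((⌊s / h⌋₊ + l : ℕ) : ℝ) * h ≤ T := by
        have h3 : ((⌊s / h⌋₊ + l : ℕ) : ℝ) ≤ t / h :=
          (Nat.cast_le.2 (by omega)).trans (Nat.floor_le (div_nonneg ht.1 hh.le))
        rw [le_div_iff₀ hh] at h3
        exact h3.trans ht.2
      have h3 := ha _ h2
      have e : a (⌊s / h⌋₊ + (l + 1)) - a ⌊s / h⌋₊ =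
          (a (⌊s / h⌋₊ + l + 1) - a (⌊s / h⌋₊ + l)) + (a (⌊s / h⌋₊ + l) - a ⌊s / h⌋₊) := by
        rw [add_assoc]; abel
      rw [e]
      refine (norm_add_le _ _).trans ?_
      push_cast
      linarith
  obtain ⟨l, hl⟩ := Nat.exists_eq_add_of_le hk
  have h1 := hsum l hl.ge
  rw [← hl] at h1
  refine h1.trans ?_
  have f1 : (⌊t / h⌋₊ : ℝ) ≤ t / h := Nat.floor_le (div_nonneg ht.1 hh.le)
  have f2 := Nat.lt_floor_add_one (s / h)
  rw [hl, le_div_iff₀ hh] at f1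
  rw [div_lt_iff₀ hh] at f2
  push_cast at f1
  have h3 : l * h ≤ |t - s| + h := by
    rw [abs_of_nonneg (sub_nonneg.2 hst)]
    linarith
  calc l * (C * h) = C * (l * h) := by ring
    _ ≤ _ := by gcongr

/-- The filter of pairs `(i, k)` such that `i → ∞` and the time `k h_i` tends to `t`. -/
def nearTime (h : ℕ → ℝ) (t : ℝ) : Filter (ℕ × ℕ) :=
  comap (fun p => (p.1, (p.2 : ℝ) * h p.1)) (atTop ×ˢ 𝓝 t)

variable {h : ℕ → ℝ} {t : ℝ}

lemma tendsto_nearTime : Tendsto (fun p : ℕ × ℕ => (p.1, (p.2 : ℝ) * h p.1)) (nearTime h t)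
    (atTop ×ˢ 𝓝 t) := tendsto_comap

lemma tendsto_fst_nearTime : Tendsto (fun p : ℕ × ℕ => p.1) (nearTime h t) atTop :=
  (tendsto_fst : Tendsto Prod.fst (atTop ×ˢ 𝓝 t) _).comp
    (f := fun p : ℕ × ℕ => (p.1, (p.2 : ℝ) * h p.1)) tendsto_nearTime

lemma tendsto_time_nearTime :
    Tendsto (fun p : ℕ × ℕ => (p.2 : ℝ) * h p.1) (nearTime h t) (𝓝 t) :=
  (tendsto_snd : Tendsto Prod.snd (atTop ×ˢ 𝓝 t) _).comp
    (f := fun p : ℕ × ℕ => (p.1, (p.2 : ℝ) * h p.1)) tendsto_nearTime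

lemma tendsto_succ_nearTime (hh : Tendsto h atTop (𝓝 0)) :
    Tendsto (fun p : ℕ × ℕ => (p.1, p.2 + 1)) (nearTime h t) (nearTime h t) := by
  rw [nearTime, tendsto_comap_iff]
  refine tendsto_fst_nearTime.prodMk ?_
  have := (tendsto_time_nearTime (h := h) (t := t)).add (hh.comp tendsto_fst_nearTime)
  rw [add_zero] at this
  refine this.congr fun p => ?_
  simp only [Function.comp]
  push_cast
  ring

lemma exists_forall_of_eventually_nearTime {P : ℕ × ℕ → Prop} (hP : ∀ᶠ p in nearTime h t, P p) :
    ∃ δ > 0, ∀ᶠ i in atTop, ∀ k : ℕ, |k * h i - t| < δ → P (i, k) := by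
  rw [nearTime, eventually_comap] at hP
  obtain ⟨P1, h1, P2, h2, h12⟩ := eventually_prod_iff.1 hP
  obtain ⟨δ, hδ, hδ'⟩ := Metric.eventually_nhds_iff.1 h2
  refine ⟨δ, hδ, ?_⟩
  filter_upwards [h1] with i hi k hk
  exact h12 hi (hδ' (by rwa [Real.dist_eq])) (i, k) rfl

lemma tendsto_of_path_nearTime {a : ℕ → ℕ → F} {A : ℝ → F} (hpos : ∀ i, 0 < h i)
    (hA : TendstoUniformlyOn (fun i s => a i ⌊s / h i⌋₊) A atTop (Icc 0 (t + 1)))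
    (hc : ContinuousWithinAt A (Ici 0) t) :
    Tendsto (fun p : ℕ × ℕ => a p.1 p.2) (nearTime h t) (𝓝 (A t)) := by
  have hmem : ∀ p : ℕ × ℕ, (p.2 : ℝ) * h p.1 ∈ Ici (0 : ℝ) := fun p =>
    mul_nonneg (Nat.cast_nonneg _) (hpos _).le
  have h1 : Tendsto (fun p : ℕ × ℕ => A (p.2 * h p.1)) (nearTime h t) (𝓝 (A t)) :=
    hc.tendsto.comp (tendsto_nhdsWithin_iff.2 ⟨tendsto_time_nearTime, .of_forall hmem⟩)
  rw [Metric.tendsto_nhds] at h1 ⊢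
  intro e he
  have h2 := tendsto_fst_nearTime (h := h) (t := t) |>.eventually
    (Metric.tendstoUniformlyOn_iff.1 hA (e / 2) (by positivity))
  filter_upwards [h1 (e / 2) (by positivity), h2, tendsto_time_nearTime.eventually_lt_const
    (show t < t + 1 by linarith)] with p p1 p2 p3
  have p4 := p2 (p.2 * h p.1) ⟨hmem p, p3.le⟩
  rw [mul_div_cancel_right₀ _ (hpos _).ne', Nat.floor_natCast] at p4
  refine (dist_triangle_left _ _ (A (p.2 * h p.1))).trans_lt ?_
  linarith

lemma tendsto_floor_div_mul (hpos : ∀ i, 0 < h i) (hh : Tendsto h atTop (𝓝 0)) {s : ℝ}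
    (hs : 0 ≤ s) : Tendsto (fun i => (⌊s / h i⌋₊ : ℝ) * h i) atTop (𝓝 s) := by
  have h1 : Tendsto (fun i => s - h i) atTop (𝓝 s) := by simpa using tendsto_const_nhds.sub hh
  refine tendsto_of_tendsto_of_tendsto_of_le_of_le h1 tendsto_const_nhds (fun i => ?_) fun i => ?_
  · have := Nat.lt_floor_add_one (s / h i)
    rw [div_lt_iff₀ (hpos i)] at this
    simp only
    linarith
  · have := Nat.floor_le (div_nonneg hs (hpos i).le)
    rwa [le_div_iff₀ (hpos i)] at this

variable [NormedSpace ℝ F]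

/-- If the difference quotients of the discrete paths near the time `t` lie in a closed convex
set, then so do the difference quotients of the limit at `t`: they are limits of averages of
discrete ones. -/
lemma eventually_slope_mem {K : Set F} (hK : Convex ℝ K) (hKc : IsClosed K) {a : ℕ → ℕ → F}
    {A : ℝ → F} (hpos : ∀ i, 0 < h i) (hh : Tendsto h atTop (𝓝 0)) (ht : 0 ≤ t)
    (hA : ∀ s, 0 ≤ s → Tendsto (fun i => a i ⌊s / h i⌋₊) atTop (𝓝 (A s)))
    (hstep : ∀ᶠ p in nearTime h t, (h p.1)⁻¹ • (a p.1 (p.2 + 1) - a p.1 p.2) ∈ K) :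
    ∀ᶠ s in 𝓝[Ici 0 \ {t}] t, slope A t s ∈ K := by
  obtain ⟨δ, hδ, hev⟩ := exists_forall_of_eventually_nearTime hstep
  have key : ∀ b c, 0 ≤ b → b < c → t - δ / 2 < b → c < t + δ → slope A b c ∈ K := by
    intro b c hb hbc hbt hct
    have hq : Tendsto (fun i => ((⌊c / h i⌋₊ : ℝ) * h i - (⌊b / h i⌋₊ : ℝ) * h i)⁻¹ •
        (a i ⌊c / h i⌋₊ - a i ⌊b / h i⌋₊)) atTop (𝓝 (slope A b c)) := by
      rw [slope_def_module]
      exact (((tendsto_floor_div_mul hpos hh (hb.trans hbc.le)).sub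
        (tendsto_floor_div_mul hpos hh hb)).inv₀ (sub_pos.2 hbc).ne').smul
        ((hA c (hb.trans hbc.le)).sub (hA b hb))
    refine hKc.mem_of_tendsto hq ?_
    filter_upwards [hev, hh.eventually_lt_const (show (0 : ℝ) < δ / 2 by positivity),
      hh.eventually_lt_const (sub_pos.2 hbc)] with i hi hi2 hi3
    have hi0 := hpos i
    have fb := Nat.lt_floor_add_one (b / h i)
    have fc := Nat.floor_le (div_nonneg (hb.trans hbc.le) hi0.le)
    rw [div_lt_iff₀ hi0] at fb
    rw [le_div_iff₀ hi0] at fc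
    have hlt : ⌊b / h i⌋₊ < ⌊c / h i⌋₊ := by
      rw [Nat.lt_iff_add_one_le, ← Nat.floor_add_one (div_nonneg hb hi0.le)]
      refine Nat.floor_mono ?_
      rw [div_add_one hi0.ne']
      gcongr
      linarith
    obtain ⟨l, hl⟩ := Nat.exists_eq_add_of_lt hlt
    set k := ⌊b / h i⌋₊
    rw [hl] at fc ⊢
    push_cast at fc
    have hl0 : (0 : ℝ) < l + 1 := by positivity
    have e : (((k + l + 1 : ℕ) : ℝ) * h i - k * h i)⁻¹ • (a i (k + l + 1) - a i k) =
        ∑ j ∈ Finset.range (l + 1), ((l : ℝ) + 1)⁻¹ •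
          ((h i)⁻¹ • (a i (k + j + 1) - a i (k + j))) := by
      have hsum := Finset.sum_range_sub (fun j => a i (k + j)) (l + 1)
      simp only [add_zero, ← add_assoc] at hsum
      rw [← Finset.smul_sum, ← Finset.smul_sum, smul_smul, hsum]
      push_cast
      rw [← sub_mul, mul_inv]
      congr 2
      ring
    rw [e]
    refine hK.sum_mem (fun _ _ => by positivity) (by simp; field_simp) fun j hj => hi _ ?_
    have hj' : (j : ℝ) ≤ l := by exact_mod_cast Nat.lt_succ_iff.1 (Finset.mem_range.1 hj)
    push_cast
    have g1 : 0 ≤ (j : ℝ) * h i := by positivity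
    have g2 : (j : ℝ) * h i ≤ l * h i := by gcongr
    rw [abs_lt]
    constructor <;> linarith
  have hball : ∀ᶠ s in 𝓝[Ici 0 \ {t}] t, |s - t| < δ / 2 :=
    mem_nhdsWithin_of_mem_nhds (Metric.ball_mem_nhds t (by positivity))
  filter_upwards [hball, self_mem_nhdsWithin] with s hs hs0
  rw [abs_lt] at hs
  rcases lt_or_gt_of_ne (show s ≠ t from hs0.2) with hst | hst
  · rw [slope_comm]
    exact key s t hs0.1 hst (by linarith) (by linarith)
  · exact key t s ht hst (by linarith) (by linarith)

lemma mem_of_hasDerivWithinAt_of_nearTime {K : Set F} (hK : Convex ℝ K) (hKc : IsClosed K)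
    {a : ℕ → ℕ → F} {A : ℝ → F} {A' : F} (hpos : ∀ i, 0 < h i) (hh : Tendsto h atTop (𝓝 0))
    (ht : 0 ≤ t) (hA : ∀ s, 0 ≤ s → Tendsto (fun i => a i ⌊s / h i⌋₊) atTop (𝓝 (A s)))
    (hstep : ∀ᶠ p in nearTime h t, (h p.1)⁻¹ • (a p.1 (p.2 + 1) - a p.1 p.2) ∈ K)
    (hA' : HasDerivWithinAt A A' (Ici 0) t) : A' ∈ K := by
  have hle : 𝓝[>] t ≤ 𝓝[Ici 0 \ {t}] t :=
    nhdsWithin_mono t fun s hs => ⟨ht.trans (mem_Ioi.1 hs).le, (mem_Ioi.1 hs).ne'⟩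
  exact hKc.mem_of_tendsto ((hasDerivWithinAt_iff_tendsto_slope.1 hA').mono_left hle)
    ((eventually_slope_mem hK hKc hpos hh ht hA hstep).filter_mono hle)

lemma hasDerivWithinAt_of_nearTime {a : ℕ → ℕ → F} {A : ℝ → F} {V : F} (hpos : ∀ i, 0 < h i)
    (hh : Tendsto h atTop (𝓝 0)) (ht : 0 ≤ t)
    (hA : ∀ s, 0 ≤ s → Tendsto (fun i => a i ⌊s / h i⌋₊) atTop (𝓝 (A s)))
    (hstep : Tendsto (fun p : ℕ × ℕ => (h p.1)⁻¹ • (a p.1 (p.2 + 1) - a p.1 p.2)) (nearTime h t)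
      (𝓝 V)) : HasDerivWithinAt A V (Ici 0) t := by
  rw [hasDerivWithinAt_iff_tendsto_slope, Metric.nhds_basis_closedBall.tendsto_right_iff]
  intro e he
  exact eventually_slope_mem (convex_closedBall V e) Metric.isClosed_closedBall hpos hh ht hA
    (hstep.eventually_mem (Metric.closedBall_mem_nhds V he))

end Paths

/-! ### The first-order system -/

/-- The equation `[θ²]' = θ` with `θ(0) > 0` has the unique solution `θ(t) = t / 2 + θ(0)`. No
continuity of `θ` is assumed: a derivative has the intermediate value property, so `θ` keeps its
sign as long as `θ²` does not vanish, and then `θ²` increases. -/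
lemma theta_eq_of_sq_hasDerivWithinAt {θ : ℝ → ℝ} {θ0 : ℝ} (hθ0 : 0 < θ0) (h0 : θ 0 = θ0)
    (hode : ∀ t, 0 ≤ t → HasDerivWithinAt (fun s => θ s ^ 2) (θ t) (Ici 0) t) :
    ∀ t, 0 ≤ t → θ t = t / 2 + θ0 := by
  have hcont : ContinuousOn (fun s => θ s ^ 2) (Ici 0) := fun t ht =>
    (hode t ht).continuousWithinAt
  have hne : ∀ t ∈ Ici (0 : ℝ), θ t ≠ 0 := by
    by_contra! hcon
    set S := Ici (0 : ℝ) ∩ (fun s => θ s ^ 2) ⁻¹' {0} with hS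
    have hScl : IsClosed S := hcont.preimage_isClosed_of_isClosed isClosed_Ici isClosed_singleton
    have hSne : S.Nonempty := by
      obtain ⟨t, ht, ht0⟩ := hcon
      exact ⟨t, ht, by simp [ht0]⟩
    have hSbdd : BddBelow S := ⟨0, fun t ht => ht.1⟩
    have hmem : sInf S ∈ S := hScl.csInf_mem hSne hSbdd
    set r := sInf S
    have hr0 : θ r = 0 := by simpa using hmem.2
    have hr : 0 < r := by
      refine lt_of_le_of_ne hmem.1 fun h => ?_
      rw [← h, h0] at hr0
      exact hθ0.ne' hr0
    have hpos : ∀ t ∈ Ico 0 r, 0 < θ t := by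
      have hd := hasDerivWithinAt_forall_lt_or_forall_gt_of_forall_ne (f := fun s => θ s ^ 2)
        (f' := θ) (m := 0) (convex_Ico 0 r)
        (fun t ht => (hode t ht.1).mono fun s hs => hs.1)
        (fun t ht ht0 => notMem_of_lt_csInf ht.2 hSbdd ⟨ht.1, by simp [ht0]⟩)
      rcases hd with hd | hd
      · have := hd 0 ⟨le_rfl, hr⟩
        rw [h0] at this
        exact absurd this hθ0.not_gt
      · exact hd
    have hmono : MonotoneOn (fun s => θ s ^ 2) (Icc 0 r) := by
      refine monotoneOn_of_hasDerivWithinAt_nonneg (f' := θ) (convex_Icc 0 r)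
        (hcont.mono fun s hs => hs.1) (fun t ht => ?_) fun t ht => ?_
      · rw [interior_Icc] at ht ⊢
        exact (hode t ht.1.le).mono fun s hs => hs.1.le
      · rw [interior_Icc] at ht
        exact (hpos t ⟨ht.1.le, ht.2⟩).le
    have h1 := hmono ⟨le_rfl, hr.le⟩ ⟨hr.le, le_rfl⟩ hr.le
    simp only [h0, hr0] at h1
    have : 0 < θ0 ^ 2 := by positivity
    linarith
  have hpos : ∀ t ∈ Ici (0 : ℝ), 0 < θ t := by
    rcases hasDerivWithinAt_forall_lt_or_forall_gt_of_forall_ne (f := fun s => θ s ^ 2)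
      (f' := θ) (m := 0) (convex_Ici 0) (fun t ht => hode t ht) hne with hd | hd
    · have := hd 0 self_mem_Ici
      rw [h0] at this
      exact absurd this hθ0.not_gt
    · exact hd
  have hderiv : ∀ t ∈ Ici (0 : ℝ), HasDerivWithinAt (fun s => θ s - s / 2) 0 (Ici 0) t := by
    intro t ht
    have h1 := (hode t ht).sqrt (pow_pos (hpos t ht) 2).ne'
    have h2 : HasDerivWithinAt θ (1 / 2) (Ici 0) t := by
      refine (h1.congr (fun s hs => ?_) ?_).congr_deriv ?_
      · exact (Real.sqrt_sq (hpos s hs).le).symm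
      · exact (Real.sqrt_sq (hpos t ht).le).symm
      · have := (hpos t ht).ne'
        rw [Real.sqrt_sq (hpos t ht).le]
        field_simp
    have h3 := h2.sub ((hasDerivWithinAt_id t (Ici 0)).div_const 2)
    exact h3.congr_deriv (by norm_num)
  intro t ht
  have := (convex_Ici (0 : ℝ)).norm_image_sub_le_of_norm_hasDerivWithin_le (C := 0) hderiv
    (fun s _ => by simp) (self_mem_Ici) (mem_Ici.2 ht)
  rw [zero_mul, norm_le_zero_iff, h0] at this
  linarith

section Flow

variable {n m : ℕ} {f : Fin m → E n → ℝ} {θ0 : ℝ} {x0 z0 : E n} {θ : ℝ → ℝ} {X Z : ℝ → E n}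

lemma IsFlow.theta_eq (h : IsFlow f θ0 x0 z0 θ X Z) (hθ0 : 0 < θ0) {t : ℝ} (ht : 0 ≤ t) :
    θ t = t / 2 + θ0 :=
  theta_eq_of_sq_hasDerivWithinAt hθ0 h.θ_zero h.θ_ode t ht

lemma hasDerivWithinAt_sq_theta (hθ : ∀ t, 0 ≤ t → θ t = t / 2 + θ0) {t : ℝ} (ht : 0 ≤ t) :
    HasDerivWithinAt (fun s => θ s ^ 2) (θ t) (Ici 0) t := by
  have h1 : HasDerivAt (fun s : ℝ => (s / 2 + θ0) ^ 2) (θ t) t := by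
    have := (((hasDerivAt_id t).div_const 2).add_const θ0).pow 2
    refine this.congr_deriv ?_
    rw [hθ t ht]
    simp
    ring
  exact h1.hasDerivWithinAt.congr (fun s hs => by rw [hθ s hs]) (by rw [hθ t ht])

lemma IsFlow.hasDerivWithinAt (h : IsFlow f θ0 x0 z0 θ X Z) {t : ℝ} (ht : 0 ≤ t) :
    HasDerivWithinAt X (derivWithin X (Ici 0) t) (Ici 0) t := by
  obtain ⟨X', h1, -⟩ := h.X_ode t ht
  exact h1.differentiableWithinAt.hasDerivWithinAt

lemma IsFlow.theta_smul_derivWithin (h : IsFlow f θ0 x0 z0 θ X Z) {t : ℝ} (ht : 0 ≤ t) :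
    θ t • derivWithin X (Ici 0) t = Z t - X t := by
  obtain ⟨X', h1, h2⟩ := h.X_ode t ht
  rw [h1.derivWithin (uniqueDiffOn_Ici 0 t ht), h2]

lemma IsFlow.Z_eq (h : IsFlow f θ0 x0 z0 θ X Z) {t : ℝ} (ht : 0 ≤ t) :
    Z t = X t + θ t • derivWithin X (Ici 0) t := by
  rw [h.theta_smul_derivWithin ht]; abel

/-! ### Equivalence with the second-order equation -/

lemma _root_.AbsolutelyContinuousOnInterval.congr {F : Type*} [PseudoMetricSpace F] {g g' : ℝ → F}
    {a b : ℝ} (hg : AbsolutelyContinuousOnInterval g a b) (h : EqOn g g' (uIcc a b)) :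
    AbsolutelyContinuousOnInterval g' a b := by
  rw [absolutelyContinuousOnInterval_iff] at hg ⊢
  intro ε hε
  obtain ⟨δ, hδ, hδ'⟩ := hg ε hε
  refine ⟨δ, hδ, fun I hI hlen => (Finset.sum_congr rfl fun i hi => ?_).trans_lt (hδ' I hI hlen)⟩
  rw [h (hI.1 i hi).1, h (hI.1 i hi).2]

/-- A path with a bounded one-sided derivative on `[0, T]` is absolutely continuous there. -/
lemma absolutelyContinuousOnInterval_of_derivWithin_bounded {F : Type*} [NormedAddCommGroup F]
    [NormedSpace ℝ F] {X V : ℝ → F} {T C : ℝ} (hT : 0 ≤ T)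
    (hX : ∀ t, 0 ≤ t → HasDerivWithinAt X (V t) (Ici 0) t) (hV : ∀ t ∈ Icc 0 T, ‖V t‖ ≤ C) :
    AbsolutelyContinuousOnInterval X 0 T := by
  refine LipschitzOnWith.absolutelyContinuousOnInterval (K := C.toNNReal) ?_
  rw [uIcc_of_le hT]
  have hC : 0 ≤ C := (norm_nonneg _).trans (hV 0 ⟨le_rfl, hT⟩)
  refine LipschitzOnWith.of_dist_le_mul fun s hs t ht => ?_
  rw [dist_eq_norm, dist_eq_norm, Real.coe_toNNReal C hC]
  exact (convex_Icc 0 T).norm_image_sub_le_of_norm_hasDerivWithin_le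
    (fun r hr => (hX r hr.1).mono fun q hq => hq.1) hV ht hs

lemma absolutelyContinuousOnInterval_affine (θ0 T : ℝ) :
    AbsolutelyContinuousOnInterval (fun s : ℝ => s / 2 + θ0) 0 T :=
  ContDiffOn.absolutelyContinuousOnInterval (by fun_prop)

/-- Differentiating `θ X' = Z - X` gives `Z' = θ X'' + (3 / 2) X'`, hence
`(3 X' - 2 Z') / (2 θ) = -X''`. -/
lemma IsFlow.isSecondOrderFlow (h : IsFlow f θ0 x0 z0 θ X Z) (hθ0 : 0 < θ0) :
    IsSecondOrderFlow f θ0 x0 (θ0⁻¹ • (z0 - x0)) X := by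
  have hpos : ∀ t : ℝ, 0 ≤ t → 0 < t / 2 + θ0 := fun t ht => by positivity
  have hV : ∀ t, 0 ≤ t → derivWithin X (Ici 0) t = (t / 2 + θ0)⁻¹ • (Z t - X t) := by
    intro t ht
    rw [← h.theta_smul_derivWithin ht, h.theta_eq hθ0 ht, inv_smul_smul₀ (hpos t ht).ne']
  refine ⟨h.X_zero, fun t ht => (h.hasDerivWithinAt ht).differentiableWithinAt, ?_, ?_, ?_⟩
  · rw [hV 0 le_rfl, h.X_zero, h.Z_zero]
    simp
  · intro T hT
    have hinv : ContinuousOn (fun s : ℝ => (s / 2 + θ0)⁻¹) (uIcc 0 T) := by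
      rw [uIcc_of_le hT]
      exact ContinuousOn.inv₀ (by fun_prop) fun t ht => (hpos t ht.1).ne'
    have hinvAC : AbsolutelyContinuousOnInterval (fun s : ℝ => (s / 2 + θ0)⁻¹) 0 T := by
      refine ContDiffOn.absolutelyContinuousOnInterval ?_
      rw [uIcc_of_le hT]
      exact ContDiffOn.inv (by fun_prop) fun t ht => (hpos t ht.1).ne'
    have hXc : ContinuousOn X (uIcc 0 T) := by
      rw [uIcc_of_le hT]
      exact fun t ht => ((h.hasDerivWithinAt ht.1).mono fun q hq => hq.1).continuousWithinAt
    have hVc : ContinuousOn (derivWithin X (Ici 0)) (uIcc 0 T) := by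
      refine (hinv.smul ((h.Z_ac T hT).continuousOn.sub hXc)).congr fun t ht => ?_
      rw [uIcc_of_le hT] at ht
      exact hV t ht.1
    obtain ⟨C, hC⟩ := isCompact_uIcc.exists_bound_of_continuousOn hVc
    rw [uIcc_of_le hT] at hC
    have hXac := absolutelyContinuousOnInterval_of_derivWithin_bounded hT
      (fun t ht => h.hasDerivWithinAt ht) hC
    refine (hinvAC.smul ((h.Z_ac T hT).sub hXac)).congr fun t ht => ?_
    rw [uIcc_of_le hT] at ht
    exact (hV t ht.1).symm
  · filter_upwards [h.Z_ode] with t ht ht0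
    obtain ⟨X', Z', hX', hZ', he⟩ := ht ht0
    have hp := hpos t ht0.le
    have hVt : derivWithin X (Ici 0) t = X' :=
      hX'.hasDerivWithinAt.derivWithin (uniqueDiffOn_Ici 0 t ht0.le)
    have hXZ : Z t - X t = (t / 2 + θ0) • X' := by
      rw [← hVt, ← h.theta_smul_derivWithin ht0.le, h.theta_eq hθ0 ht0.le]
    have h1 : HasDerivAt (fun s : ℝ => s / 2 + θ0) (1 / 2) t := by
      simpa using ((hasDerivAt_id t).div_const 2).add_const θ0
    have h2 := (h1.inv hp.ne').smul (hZ'.sub hX')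
    rw [h.theta_eq hθ0 ht0.le] at he
    refine ⟨(t / 2 + θ0)⁻¹ • (Z' - (3 / 2 : ℝ) • X'), ?_, ?_⟩
    · refine (h2.congr_of_eventuallyEq ?_).congr_deriv ?_
      · filter_upwards [eventually_gt_nhds ht0] with s hs
        exact hV s hs.le
      · simp only [Pi.sub_apply, Pi.inv_apply]
        rw [hXZ, smul_smul]
        have e : -(1 / 2) / (t / 2 + θ0) ^ 2 * (t / 2 + θ0) = (t / 2 + θ0)⁻¹ * (-(1 / 2)) := by
          field_simp
        rw [e]
        module
    · have e1 : -((t / 2 + θ0)⁻¹ • (Z' - (3 / 2 : ℝ) • X')) =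
          (2 * (t / 2 + θ0))⁻¹ • ((3 : ℝ) • X' - (2 : ℝ) • Z') := by
        rw [mul_inv]; module
      have e2 : 3 / (t + 2 * θ0) = (t / 2 + θ0)⁻¹ * (3 / 2) := by
        have : t + 2 * θ0 ≠ 0 := by positivity
        field_simp
      rw [e1, hVt, e2]
      set P := proj (gradHull f (X t)) ((2 * (t / 2 + θ0))⁻¹ • ((3 : ℝ) • X' - (2 : ℝ) • Z'))
      have e3 : P = -((t / 2 + θ0)⁻¹ • Z') := by
        rw [he, smul_neg, neg_neg, inv_smul_smul₀ hp.ne']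
      rw [e3]
      module

lemma IsSecondOrderFlow.isFlow (hθ0 : 0 < θ0) (hθ : ∀ t, 0 ≤ t → θ t = t / 2 + θ0)
    (hZ : ∀ t, 0 ≤ t → Z t = X t + θ t • derivWithin X (Ici 0) t)
    (h : IsSecondOrderFlow f θ0 x0 (θ0⁻¹ • (z0 - x0)) X) : IsFlow f θ0 x0 z0 θ X Z := by
  have hθz : θ 0 = θ0 := by rw [hθ 0 le_rfl]; simp
  have hX : ∀ t, 0 ≤ t → HasDerivWithinAt X (derivWithin X (Ici 0) t) (Ici 0) t := fun t ht =>
    (h.X_diff t ht).hasDerivWithinAt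
  refine ⟨hθz, h.X_zero, ?_, fun t ht => hasDerivWithinAt_sq_theta hθ ht,
    fun t ht => ⟨_, hX t ht, ?_⟩, ?_, ?_⟩
  · rw [hZ 0 le_rfl, hθz, h.V_zero, h.X_zero, smul_inv_smul₀ hθ0.ne']
    abel
  · rw [hZ t ht]; abel
  · intro T hT
    obtain ⟨C, hC⟩ := (h.V_ac T hT).exists_bound
    rw [uIcc_of_le hT] at hC
    have hXac := absolutelyContinuousOnInterval_of_derivWithin_bounded hT hX hC
    refine (hXac.add ((absolutelyContinuousOnInterval_affine θ0 T).smul (h.V_ac T hT))).congr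
      fun t ht => ?_
    rw [uIcc_of_le hT] at ht
    rw [hZ t ht.1, hθ t ht.1]
    rfl
  · filter_upwards [h.ode] with t ht ht0
    obtain ⟨X'', hX'', he⟩ := ht ht0
    have hp : 0 < t / 2 + θ0 := by positivity
    have hX' : HasDerivAt X (derivWithin X (Ici 0) t) t :=
      (hX t ht0.le).hasDerivAt (Ici_mem_nhds ht0)
    set V := derivWithin X (Ici 0) t with hV
    have h1 : HasDerivAt (fun s : ℝ => s / 2 + θ0) (1 / 2) t := by
      simpa using ((hasDerivAt_id t).div_const 2).add_const θ0
    have h2 := hX'.add (h1.smul hX'')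
    refine ⟨V, V + ((t / 2 + θ0) • X'' + (1 / 2 : ℝ) • V), hX', ?_, ?_⟩
    · refine h2.congr_of_eventuallyEq ?_
      filter_upwards [eventually_gt_nhds ht0] with s hs
      rw [hZ s hs.le, hθ s hs.le]
      rfl
    · rw [hθ t ht0.le]
      have e1 : (2 * (t / 2 + θ0))⁻¹ • ((3 : ℝ) • V -
          (2 : ℝ) • (V + ((t / 2 + θ0) • X'' + (1 / 2 : ℝ) • V))) = -X'' := by
        have : (3 : ℝ) • V - (2 : ℝ) • (V + ((t / 2 + θ0) • X'' + (1 / 2 : ℝ) • V)) =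
            (2 * (t / 2 + θ0)) • (-X'') := by module
        rw [this, inv_smul_smul₀ (by positivity)]
      have e2 : (t / 2 + θ0) * (3 / (t + 2 * θ0)) = 3 / 2 := by
        have : t + 2 * θ0 ≠ 0 := by positivity
        field_simp
      rw [e1, ← smul_neg, ← eq_neg_of_add_eq_zero_left he, smul_add, smul_smul, e2]
      module

end Flow

/-! ### Projection onto the hull of the gradients -/

lemma proj_add_eq_of_forall_inner_le {n : ℕ} {C : Set (E n)} (hcl : IsClosed C)
    (hconv : Convex ℝ C) {p v : E n} (hp : p ∈ C) (h : ∀ c ∈ C, inner ℝ v c ≤ inner ℝ v p) :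
    proj C (p + v) = p := by
  refine ((proj_spec ⟨p, hp⟩ hcl hconv (p + v)).2 p hp fun c hc => ?_).symm
  have e1 : p - (p + v) = -v := by abel
  have e2 : c - (p + v) = (c - p) - v := by abel
  rw [e1, e2, norm_neg]
  refine le_of_sq_le_sq ?_ (norm_nonneg _)
  rw [norm_sub_sq_real (c - p) v, real_inner_comm, inner_sub_right]
  have := h c hc
  nlinarith [sq_nonneg ‖c - p‖]

lemma isClosed_gradHull {n m : ℕ} (f : Fin m → E n → ℝ) (x : E n) : IsClosed (gradHull f x) :=
  (finite_range _).isClosed_convexHull ℝ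

/-- A point that no direction separates from the gradients lies in their convex hull. -/
lemma mem_gradHull_of_forall_inner_le {n m : ℕ} {f : Fin m → E n → ℝ} {x p : E n}
    (h : ∀ d, ∃ j, inner ℝ p d ≤ inner ℝ (gradient (f j) x) d) : p ∈ gradHull f x := by
  by_contra hp
  obtain ⟨φ, u, h1, h2⟩ :=
    geometric_hahn_banach_closed_point (convex_convexHull ℝ _) (isClosed_gradHull f x) hp
  obtain ⟨j, hj⟩ := h ((InnerProductSpace.toDual ℝ (E n)).symm φ)
  rw [real_inner_comm, InnerProductSpace.toDual_symm_apply, real_inner_comm,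
    InnerProductSpace.toDual_symm_apply] at hj
  have := h1 _ (subset_convexHull ℝ _ (mem_range_self j))
  linarith

lemma inner_le_of_mem_gradHull {n m : ℕ} {f : Fin m → E n → ℝ} {x v c : E n} {b : ℝ}
    (h : ∀ j, inner ℝ v (gradient (f j) x) ≤ b) (hc : c ∈ gradHull f x) : inner ℝ v c ≤ b := by
  have hconv : Convex ℝ {c : E n | inner ℝ v c ≤ b} :=
    convex_halfSpace_le (innerSL ℝ v).toLinearMap.isLinear b
  exact convexHull_min (by rintro _ ⟨j, rfl⟩; exact h j) hconv hc

/-- The projection equation of the first-order system says that `-Z' / θ` is a point of `C(X)`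
that maximizes `⟪X', ·⟫` over `C(X)`; both conditions are families of linear inequalities. -/
lemma eq_neg_smul_proj_of_inner_le {n m : ℕ} {f : Fin m → E n → ℝ} {X X' Z' : E n} {θ : ℝ}
    (hθ : 0 < θ) (h1 : ∀ d, ∃ j, -(θ * inner ℝ (gradient (f j) X) d) ≤ inner ℝ Z' d)
    (h2 : ∀ i, inner ℝ Z' X' ≤ -(θ * inner ℝ (gradient (f i) X) X')) :
    Z' = -(θ • proj (gradHull f X) ((2 * θ)⁻¹ • ((3 : ℝ) • X' - (2 : ℝ) • Z'))) := by
  set p := -(θ⁻¹ • Z') with hp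
  have hZ : Z' = -(θ • p) := by rw [hp, smul_neg, smul_inv_smul₀ hθ.ne', neg_neg]
  have e : (2 * θ)⁻¹ • ((3 : ℝ) • X' - (2 : ℝ) • Z') = p + (3 / 2 * θ⁻¹) • X' := by
    rw [hp, mul_inv]; module
  have hpZ : ∀ d, inner ℝ Z' d = -(θ * inner ℝ p d) := fun d => by
    conv_lhs => rw [hZ]
    rw [inner_neg_left, inner_smul_left]
    simp
  rw [e, proj_add_eq_of_forall_inner_le (isClosed_gradHull f X) (convex_convexHull ℝ _)]
  · exact hZ
  · refine mem_gradHull_of_forall_inner_le fun d => ?_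
    obtain ⟨j, hj⟩ := h1 d
    rw [hpZ, neg_le_neg_iff] at hj
    exact ⟨j, le_of_mul_le_mul_left hj hθ⟩
  · intro c hc
    rw [inner_smul_left, inner_smul_left]
    simp only [conj_trivial]
    refine mul_le_mul_of_nonneg_left ?_ (by positivity)
    refine inner_le_of_mem_gradHull (fun j => ?_) hc
    have := h2 j
    rw [hpZ, neg_le_neg_iff] at this
    rw [real_inner_comm, real_inner_comm p]
    exact le_of_mul_le_mul_left this hθ

/-! ### The limit of the method solves the first-order system -/

section Limit

variable {n m : ℕ} {f : Fin m → E n → ℝ} {L : Fin m → ℝ≥0} {θ0 : ℝ} {x0 z0 : E n}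
  {u : ℕ → ℝ} {th : ℕ → ℕ → ℝ} {x y z : ℕ → ℕ → E n}

lemma tendsto_sqrt_zero (hu : Tendsto u atTop (𝓝 0)) :
    Tendsto (fun i => √(u i)) atTop (𝓝 0) := by
  simpa using hu.sqrt

/-- The parameter paths converge to `t / 2 + θ0`, uniformly on bounded time intervals. -/
lemma tendstoUniformlyOn_theta (hθ0 : 0 < θ0) (hpos : ∀ i, 0 < u i)
    (hu : Tendsto u atTop (𝓝 0))
    (hA : ∀ i, IsAPG f (u i) (√(u i) / θ0) x0 z0 (th i) (x i) (y i) (z i)) (T : ℝ) :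
    TendstoUniformlyOn (fun i t => √(u i) / th i ⌊t / √(u i)⌋₊) (fun t => t / 2 + θ0) atTop
      (Icc 0 T) := by
  rw [Metric.tendstoUniformlyOn_iff]
  intro e he
  have h1 : Tendsto (fun i => √(u i) / 2 + T * √(u i) / (8 * θ0)) atTop (𝓝 0) := by
    have := tendsto_sqrt_zero hu
    simpa using (this.div_const 2).add ((this.const_mul T).div_const (8 * θ0))
  filter_upwards [h1.eventually_lt_const he] with i hi t ht
  have hs := Real.sqrt_pos.2 (hpos i)
  obtain ⟨b1, b2⟩ := (hA i).scaled_theta_bounds (hpos i) hθ0 ⌊t / √(u i)⌋₊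
  have f1 := Nat.lt_floor_add_one (t / √(u i))
  have f2 := Nat.floor_le (div_nonneg ht.1 hs.le)
  rw [div_lt_iff₀ hs] at f1
  rw [le_div_iff₀ hs] at f2
  have h2 : (⌊t / √(u i)⌋₊ : ℝ) * √(u i) * √(u i) / (8 * θ0) ≤ T * √(u i) / (8 * θ0) := by
    gcongr
    exact f2.trans ht.2
  have h3 : 0 ≤ T * √(u i) / (8 * θ0) := by
    have : 0 ≤ T := ht.1.trans ht.2
    positivity
  rw [Real.dist_eq, abs_lt]
  constructor <;> linarith

/-- The limit paths are Lipschitz on bounded time intervals. -/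
lemma exists_lipschitz_of_discreteTendsto [Nonempty (Fin m)] (hf : ∀ j, IsSmoothClass (L j) (f j))
    (hθ0 : 0 < θ0) (hpos : ∀ i, 0 < u i) (hu : Tendsto u atTop (𝓝 0))
    (hA : ∀ i, IsAPG f (u i) (√(u i) / θ0) x0 z0 (th i) (x i) (y i) (z i))
    {X Z : ℝ → E n} (hX : ∀ s, 0 ≤ s → Tendsto (fun i => x i ⌊s / √(u i)⌋₊) atTop (𝓝 (X s)))
    (hZ : ∀ s, 0 ≤ s → Tendsto (fun i => z i ⌊s / √(u i)⌋₊) atTop (𝓝 (Z s)))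
    {T : ℝ} (hT : 0 ≤ T) :
    ∃ C : ℝ≥0, LipschitzOnWith C X (Icc 0 T) ∧ LipschitzOnWith C Z (Icc 0 T) := by
  obtain ⟨C, hC, h0, hh0, hb⟩ := exists_apriori_bound hf hθ0 x0 z0 hT
  have hs0 := tendsto_sqrt_zero hu
  have key : ∀ s t : ℝ, Tendsto (fun i => C * (|t - s| + √(u i))) atTop (𝓝 (C * |t - s|)) := by
    intro s t
    simpa using (hs0.const_add |t - s|).const_mul C
  refine ⟨C.toNNReal, LipschitzOnWith.of_dist_le_mul fun t ht s hs => ?_,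
    LipschitzOnWith.of_dist_le_mul fun t ht s hs => ?_⟩ <;>
  rw [dist_eq_norm, Real.dist_eq, Real.coe_toNNReal C hC]
  · refine le_of_tendsto_of_tendsto ((hX t ht.1).sub (hX s hs.1)).norm (key s t) ?_
    filter_upwards [hs0.eventually_lt_const hh0] with i hi
    exact norm_path_sub_le hC (Real.sqrt_pos.2 (hpos i))
      (fun k hk => (hb _ _ _ _ _ (hpos i) hi.le (hA i) k hk).2.2.1) hs ht
  · refine le_of_tendsto_of_tendsto ((hZ t ht.1).sub (hZ s hs.1)).norm (key s t) ?_
    filter_upwards [hs0.eventually_lt_const hh0] with i hi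
    exact norm_path_sub_le hC (Real.sqrt_pos.2 (hpos i))
      (fun k hk => (hb _ _ _ _ _ (hpos i) hi.le (hA i) k hk).2.2.2) hs ht

/-- Consistency of the method near the time `t`, in terms of the limits of the iterates at the
times `k √τ → t`. The optimality conditions of the proximal step are linear inequalities for the
difference quotient of `z_k`; they survive the averaging in the limit. -/
lemma consistency_of_nearTime [Nonempty (Fin m)] (hf : ∀ j, IsSmoothClass (L j) (f j))
    (hθ0 : 0 < θ0) (hpos : ∀ i, 0 < u i) (hu : Tendsto u atTop (𝓝 0))
    (hA : ∀ i, IsAPG f (u i) (√(u i) / θ0) x0 z0 (th i) (x i) (y i) (z i))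
    {X Z : ℝ → E n} (hX : ∀ s, 0 ≤ s → Tendsto (fun i => x i ⌊s / √(u i)⌋₊) atTop (𝓝 (X s)))
    (hZ : ∀ s, 0 ≤ s → Tendsto (fun i => z i ⌊s / √(u i)⌋₊) atTop (𝓝 (Z s)))
    {t θ : ℝ} (ht : 0 ≤ t) (hθ : 0 < θ)
    (hS : Tendsto (fun p : ℕ × ℕ => √(u p.1) / th p.1 p.2) (nearTime (fun i => √(u i)) t) (𝓝 θ))
    (hx : Tendsto (fun p : ℕ × ℕ => x p.1 p.2) (nearTime (fun i => √(u i)) t) (𝓝 (X t)))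
    (hz : Tendsto (fun p : ℕ × ℕ => z p.1 p.2) (nearTime (fun i => √(u i)) t) (𝓝 (Z t))) :
    HasDerivWithinAt X (θ⁻¹ • (Z t - X t)) (Ici 0) t ∧
      ∀ Z', HasDerivWithinAt Z Z' (Ici 0) t →
        Z' = -(θ • proj (gradHull f (X t))
          ((2 * θ)⁻¹ • ((3 : ℝ) • (θ⁻¹ • (Z t - X t)) - (2 : ℝ) • Z'))) := by
  have hspos : ∀ i, 0 < √(u i) := fun i => Real.sqrt_pos.2 (hpos i)
  have hs0 := tendsto_sqrt_zero hu
  have hapos : ∀ i, 0 < √(u i) / θ0 := fun i => div_pos (hspos i) hθ0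
  set l := nearTime (fun i => √(u i)) t with hl
  set V := θ⁻¹ • (Z t - X t) with hVdef
  have hh : Tendsto (fun p : ℕ × ℕ => √(u p.1)) l (𝓝 0) := hs0.comp tendsto_fst_nearTime
  have hz1 : Tendsto (fun p : ℕ × ℕ => z p.1 (p.2 + 1)) l (𝓝 (Z t)) :=
    hz.comp (tendsto_succ_nearTime hs0)
  have hth : ∀ p : ℕ × ℕ, th p.1 p.2 = √(u p.1) * (√(u p.1) / th p.1 p.2)⁻¹ := fun p => by
    rw [inv_div, mul_div_cancel₀ _ (hspos p.1).ne']
  have hv : Tendsto (fun p : ℕ × ℕ => (√(u p.1))⁻¹ • (x p.1 (p.2 + 1) - x p.1 p.2)) l (𝓝 V) := by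
    refine ((hS.inv₀ hθ.ne').smul (hz1.sub hx)).congr fun p => ?_
    rw [(hA p.1).x_step (hapos p.1), smul_smul, inv_div, div_eq_inv_mul]
  have hyx : Tendsto (fun p : ℕ × ℕ => y p.1 p.2 - x p.1 p.2) l (𝓝 0) := by
    have := (hh.mul (hS.inv₀ hθ.ne')).smul (hz.sub hx)
    rw [zero_mul, zero_smul] at this
    refine this.congr fun p => ?_
    rw [← hth, (hA p.1).y_eq, add_sub_cancel_left]
  have hy : Tendsto (fun p : ℕ × ℕ => y p.1 p.2) l (𝓝 (X t)) := by
    have := hyx.add hx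
    rw [zero_add] at this
    exact this.congr fun p => by abel
  have herr : Tendsto (fun p : ℕ × ℕ => (√(u p.1))⁻¹ * ‖y p.1 p.2 - x p.1 p.2‖ ^ 2) l (𝓝 0) := by
    have := hh.mul (((hS.inv₀ hθ.ne').smul (hz.sub hx)).norm.pow 2)
    rw [zero_mul] at this
    refine this.congr fun p => ?_
    have hs := hspos p.1
    rw [(hA p.1).y_eq, add_sub_cancel_left]
    conv_rhs => rw [hth p, mul_smul, norm_smul, Real.norm_of_nonneg hs.le]
    field_simp
  have hg : ∀ j, Tendsto (fun p : ℕ × ℕ => gradient (f j) (y p.1 p.2)) l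
      (𝓝 (gradient (f j) (X t))) := fun j =>
    ((hf j).2.continuous.tendsto _).comp hy
  have hzq : ∀ p : ℕ × ℕ, (√(u p.1))⁻¹ • (z p.1 (p.2 + 1) - z p.1 p.2) =
      -(√(u p.1) / th p.1 p.2) • ((u p.1)⁻¹ • (y p.1 p.2 - x p.1 (p.2 + 1))) := fun p => by
    rw [(hA p.1).z_step (hapos p.1) (hpos p.1), smul_smul, mul_neg, ← mul_assoc,
      inv_mul_cancel₀ (hspos p.1).ne', one_mul]
  have hSpos : ∀ p : ℕ × ℕ, 0 < √(u p.1) / th p.1 p.2 := fun p =>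
    div_pos (hspos p.1) ((hA p.1).th_pos (hapos p.1) p.2)
  refine ⟨hasDerivWithinAt_of_nearTime hspos hs0 ht hX hv, fun Z' hZ' => ?_⟩
  refine eq_neg_smul_proj_of_inner_le hθ (fun d => ?_) fun i => ?_
  · -- the active index varies with `(i, k)`; an index that is extremal in the limit serves for all
    obtain ⟨j, hj⟩ := Finite.exists_max fun j => inner ℝ (gradient (f j) (X t)) d
    refine ⟨j, le_of_forall_pos_sub_le fun e he => ?_⟩
    have hK : Convex ℝ {v : E n | -(θ * inner ℝ (gradient (f j) (X t)) d) - e ≤ inner ℝ d v} :=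
      convex_halfSpace_ge (innerSL ℝ d).toLinearMap.isLinear _
    have hKc : IsClosed {v : E n | -(θ * inner ℝ (gradient (f j) (X t)) d) - e ≤ inner ℝ d v} :=
      isClosed_le continuous_const (by fun_prop)
    have := mem_of_hasDerivWithinAt_of_nearTime hK hKc hspos hs0 ht hZ ?_ hZ'
    · rw [real_inner_comm d Z']; exact this
    have hev : ∀ᶠ p in l, ∀ i, √(u p.1) / th p.1 p.2 * inner ℝ (gradient (f i) (y p.1 p.2)) d <
        θ * inner ℝ (gradient (f j) (X t)) d + e := by
      refine eventually_all.2 fun i => ?_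
      have h1 := hS.mul ((hg i).inner (tendsto_const_nhds (x := d)))
      refine h1.eventually_lt_const ?_
      have := mul_le_mul_of_nonneg_left (hj i) hθ.le
      linarith
    filter_upwards [hev] with p hp
    obtain ⟨i, -, hi⟩ := exists_active_inner_le ((hA p.1).x_succ p.2) d
    have h2 := mul_le_mul_of_nonneg_left hi (hSpos p).le
    have h3 := hp i
    rw [hzq, neg_smul, inner_neg_right, inner_smul_right _ _ (√(u p.1) / th p.1 p.2),
      real_inner_comm ((u p.1)⁻¹ • (y p.1 p.2 - x p.1 (p.2 + 1))) d]
    linarith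
  · -- near-maximality holds in the direction of the discrete velocity; the bound on `ξ` from
    -- `norm_step_le` allows replacing that velocity by its limit `V`
    refine le_of_forall_pos_le_add fun e he => ?_
    have hK : Convex ℝ {v : E n | inner ℝ V v ≤ -(θ * inner ℝ (gradient (f i) (X t)) V) + e} :=
      convex_halfSpace_le (innerSL ℝ V).toLinearMap.isLinear _
    have hKc : IsClosed {v : E n | inner ℝ V v ≤ -(θ * inner ℝ (gradient (f i) (X t)) V) + e} :=
      isClosed_le (by fun_prop) continuous_const
    have := mem_of_hasDerivWithinAt_of_nearTime hK hKc hspos hs0 ht hZ ?_ hZ'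
    · rw [real_inner_comm]; exact this
    have h1 : Tendsto (fun p : ℕ × ℕ => √(u p.1) / th p.1 p.2 *
        (inner ℝ (gradient (f i) (y p.1 p.2)) ((√(u p.1))⁻¹ • (x p.1 (p.2 + 1) - x p.1 p.2)) -
          2 * (∑ j, (L j : ℝ)) * ((√(u p.1))⁻¹ * ‖y p.1 p.2 - x p.1 p.2‖ ^ 2) -
          (∑ j, ‖gradient (f j) (y p.1 p.2)‖) *
            ‖(√(u p.1))⁻¹ • (x p.1 (p.2 + 1) - x p.1 p.2) - V‖)) l
        (𝓝 (θ * (inner ℝ (gradient (f i) (X t)) V - 2 * (∑ j, (L j : ℝ)) * 0 -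
          (∑ j, ‖gradient (f j) (X t)‖) * ‖V - V‖))) :=
      hS.mul ((((hg i).inner hv).sub (herr.const_mul _)).sub
        ((tendsto_finsetSum _ fun j _ => (hg j).norm).mul (hv.sub_const V).norm))
    simp only [mul_zero, sub_zero, sub_self, norm_zero] at h1
    filter_upwards [h1.eventually_const_lt (sub_lt_self _ he)] with p hp
    have hw := (hA p.1).x_succ p.2
    have h2 := inner_sub_le_inner_step hf hw i
    have h3 := norm_step_le hw
    set ξ := (u p.1)⁻¹ • (y p.1 p.2 - x p.1 (p.2 + 1))
    set v := (√(u p.1))⁻¹ • (x p.1 (p.2 + 1) - x p.1 p.2) with hvdef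
    have h4 : inner ℝ (gradient (f i) (y p.1 p.2)) v -
        2 * (∑ j, (L j : ℝ)) * ((√(u p.1))⁻¹ * ‖y p.1 p.2 - x p.1 p.2‖ ^ 2) ≤ inner ℝ ξ v := by
      have := mul_le_mul_of_nonneg_left h2 (inv_pos.2 (hspos p.1)).le
      rw [hvdef, inner_smul_right, inner_smul_right]
      linarith
    have h5 : inner ℝ ξ v - (∑ j, ‖gradient (f j) (y p.1 p.2)‖) * ‖v - V‖ ≤ inner ℝ ξ V := by
      have h6 : inner ℝ ξ (v - V) ≤ (∑ j, ‖gradient (f j) (y p.1 p.2)‖) * ‖v - V‖ :=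
        (real_inner_le_norm _ _).trans (by gcongr)
      rw [inner_sub_right] at h6
      linarith
    have h7 := mul_le_mul_of_nonneg_left ((sub_le_sub_right h4 _).trans h5) (hSpos p).le
    rw [hzq, neg_smul, inner_neg_right, inner_smul_right _ _ (√(u p.1) / th p.1 p.2),
      real_inner_comm ξ V]
    linarith

/-- A locally uniform limit of the discrete paths solves the first-order system. -/
lemma isFlow_of_discreteTendsto_of_pos [Nonempty (Fin m)] (hf : ∀ j, IsSmoothClass (L j) (f j))
    (hθ0 : 0 < θ0) (hpos : ∀ i, 0 < u i) (hu : Tendsto u atTop (𝓝 0))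
    (hA : ∀ i, IsAPG f (u i) (√(u i) / θ0) x0 z0 (th i) (x i) (y i) (z i))
    {θ : ℝ → ℝ} {X Z : ℝ → E n} (hlim : DiscreteTendsto atTop u th x z θ X Z) :
    IsFlow f θ0 x0 z0 θ X Z := by
  have hspos : ∀ i, 0 < √(u i) := fun i => Real.sqrt_pos.2 (hpos i)
  have hX : ∀ s, 0 ≤ s → Tendsto (fun i => x i ⌊s / √(u i)⌋₊) atTop (𝓝 (X s)) := fun s hs =>
    (hlim s).2.1.tendsto_at ⟨hs, le_rfl⟩
  have hZ : ∀ s, 0 ≤ s → Tendsto (fun i => z i ⌊s / √(u i)⌋₊) atTop (𝓝 (Z s)) := fun s hs =>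
    (hlim s).2.2.tendsto_at ⟨hs, le_rfl⟩
  have hθ : ∀ t, 0 ≤ t → θ t = t / 2 + θ0 := fun t ht =>
    tendsto_nhds_unique ((hlim t).1.tendsto_at ⟨ht, le_rfl⟩)
      ((tendstoUniformlyOn_theta hθ0 hpos hu hA t).tendsto_at ⟨ht, le_rfl⟩)
  have hLip := fun T (hT : (0 : ℝ) ≤ T) =>
    exists_lipschitz_of_discreteTendsto hf hθ0 hpos hu hA hX hZ hT
  have hnhds : ∀ t : ℝ, 0 ≤ t → Icc 0 (t + 1) ∈ 𝓝[Ici 0] t := fun t ht => by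
    rw [← Ici_inter_Iic]
    exact inter_mem self_mem_nhdsWithin (mem_nhdsWithin_of_mem_nhds (Iic_mem_nhds (by linarith)))
  have hXc : ∀ t, 0 ≤ t → ContinuousWithinAt X (Ici 0) t := fun t ht => by
    obtain ⟨C, hC, -⟩ := hLip (t + 1) (by linarith)
    exact (hC.continuousOn t ⟨ht, by linarith⟩).mono_of_mem_nhdsWithin (hnhds t ht)
  have hZc : ∀ t, 0 ≤ t → ContinuousWithinAt Z (Ici 0) t := fun t ht => by
    obtain ⟨C, -, hC⟩ := hLip (t + 1) (by linarith)
    exact (hC.continuousOn t ⟨ht, by linarith⟩).mono_of_mem_nhdsWithin (hnhds t ht)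
  have hcons : ∀ t, 0 ≤ t → HasDerivWithinAt X ((θ t)⁻¹ • (Z t - X t)) (Ici 0) t ∧
      ∀ Z', HasDerivWithinAt Z Z' (Ici 0) t →
        Z' = -(θ t • proj (gradHull f (X t))
          ((2 * θ t)⁻¹ • ((3 : ℝ) • ((θ t)⁻¹ • (Z t - X t)) - (2 : ℝ) • Z'))) := by
    intro t ht
    have hθc : ContinuousWithinAt (fun s : ℝ => s / 2 + θ0) (Ici 0) t :=
      Continuous.continuousWithinAt (by fun_prop)
    rw [hθ t ht]
    refine consistency_of_nearTime hf hθ0 hpos hu hA hX hZ ht (by positivity) ?_ ?_ ?_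
    · exact tendsto_of_path_nearTime (a := fun i k => √(u i) / th i k) hspos
        (tendstoUniformlyOn_theta hθ0 hpos hu hA (t + 1)) hθc
    · exact tendsto_of_path_nearTime hspos (hlim (t + 1)).2.1 (hXc t ht)
    · exact tendsto_of_path_nearTime hspos (hlim (t + 1)).2.2 (hZc t ht)
  have hθpos : ∀ t, 0 ≤ t → 0 < θ t := fun t ht => by rw [hθ t ht]; positivity
  refine ⟨by rw [hθ 0 le_rfl]; simp, ?_, ?_, fun t ht => hasDerivWithinAt_sq_theta hθ ht,
    fun t ht => ⟨_, (hcons t ht).1, smul_inv_smul₀ (hθpos t ht).ne' _⟩, fun T hT => ?_, ?_⟩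
  · refine tendsto_nhds_unique (hX 0 le_rfl) (tendsto_const_nhds.congr fun i => ?_)
    simp [(hA i).x_zero]
  · refine tendsto_nhds_unique (hZ 0 le_rfl) (tendsto_const_nhds.congr fun i => ?_)
    simp [(hA i).z_zero]
  · obtain ⟨C, -, hC⟩ := hLip T hT
    rw [← uIcc_of_le hT] at hC
    exact hC.absolutelyContinuousOnInterval
  · have hae : ∀ N : ℕ, ∀ᵐ t : ℝ, t ∈ Icc (0 : ℝ) N → DifferentiableWithinAt ℝ Z (Icc 0 N) t := by
      intro N
      obtain ⟨C, -, hC⟩ := hLip N (Nat.cast_nonneg N)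
      exact hC.ae_differentiableWithinAt_of_mem_real
    filter_upwards [ae_all_iff.2 hae] with t ht ht0
    obtain ⟨N, hN⟩ := exists_nat_gt t
    have hd := (ht N ⟨ht0.le, hN.le⟩).differentiableAt (Icc_mem_nhds ht0 hN)
    exact ⟨_, _, (hcons t ht0.le).1.hasDerivAt (Ici_mem_nhds ht0), hd.hasDerivAt,
      (hcons t ht0.le).2 _ hd.hasDerivAt.hasDerivWithinAt⟩

end Limit

/-! ### Compactness and convergence of the method -/

section Convergence

variable {n m : ℕ} {f : Fin m → E n → ℝ} {L : Fin m → ℝ≥0} {θ0 : ℝ} {x0 z0 : E n}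

lemma tendstoUniformlyOn_comp_tendsto {ι κ α β : Type*} [UniformSpace β] {F : ι → α → β}
    {g : α → β} {l : Filter ι} {l' : Filter κ} {s : Set α} {φ : κ → ι}
    (h : TendstoUniformlyOn F g l s) (hφ : Tendsto φ l' l) :
    TendstoUniformlyOn (fun k => F (φ k)) g l' s :=
  fun v hv => hφ.eventually (h v hv)

lemma DiscreteTendsto.comp_tendsto {ι κ : Type*} {l : Filter ι} {l' : Filter κ} {τ : ι → ℝ}
    {th : ι → ℕ → ℝ} {x z : ι → ℕ → E n} {θ : ℝ → ℝ} {X Z : ℝ → E n} {φ : κ → ι}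
    (h : DiscreteTendsto l τ th x z θ X Z) (hφ : Tendsto φ l' l) :
    DiscreteTendsto l' (fun k => τ (φ k)) (fun k => th (φ k)) (fun k => x (φ k))
      (fun k => z (φ k)) θ X Z := fun T =>
  ⟨tendstoUniformlyOn_comp_tendsto (h T).1 hφ, tendstoUniformlyOn_comp_tendsto (h T).2.1 hφ,
    tendstoUniformlyOn_comp_tendsto (h T).2.2 hφ⟩

/-- Uniform convergence along a countably generated filter may be checked on subsequences. -/
lemma tendstoUniformlyOn_of_subseq {ι α β : Type*} [UniformSpace β] {F : ι → α → β} {g : α → β}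
    {l : Filter ι} [l.IsCountablyGenerated] {s : Set α}
    (h : ∀ u : ℕ → ι, Tendsto u atTop l → ∃ φ : ℕ → ℕ,
      TendstoUniformlyOn (fun i => F (u (φ i))) g atTop s) : TendstoUniformlyOn F g l s := by
  intro v hv
  by_contra hcon
  obtain ⟨u, hu, hu'⟩ := exists_seq_forall_of_frequently (not_eventually.1 hcon)
  obtain ⟨φ, hφ⟩ := h u hu
  obtain ⟨i, hi⟩ := (hφ v hv).exists
  exact hu' (φ i) hi

lemma exists_forall_ge_pos {u : ℕ → ℝ} (hu : Tendsto u atTop (𝓝[>] 0)) :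
    ∃ N, ∀ i, 0 < u (i + N) := by
  obtain ⟨N, hN⟩ := eventually_atTop.1 (hu.eventually self_mem_nhdsWithin)
  exact ⟨N, fun i => hN (i + N) (Nat.le_add_left _ _)⟩

variable {th : ℝ → ℕ → ℝ} {x y z : ℝ → ℕ → E n}

lemma isFlow_of_discreteTendsto [Nonempty (Fin m)] (hf : ∀ j, IsSmoothClass (L j) (f j))
    (hθ0 : 0 < θ0) (hA : ∀ τ, 0 < τ → IsAPG f τ (√τ / θ0) x0 z0 (th τ) (x τ) (y τ) (z τ))
    {u : ℕ → ℝ} (hu : Tendsto u atTop (𝓝[>] 0)) {θ : ℝ → ℝ} {X Z : ℝ → E n}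
    (hlim : DiscreteTendsto atTop u (fun i => th (u i)) (fun i => x (u i)) (fun i => z (u i))
      θ X Z) : IsFlow f θ0 x0 z0 θ X Z := by
  obtain ⟨N, hN⟩ := exists_forall_ge_pos hu
  exact isFlow_of_discreteTendsto_of_pos hf hθ0 hN
    ((tendsto_nhds_of_tendsto_nhdsWithin hu).comp (tendsto_add_atTop_nat N))
    (fun i => hA _ (hN i)) (hlim.comp_tendsto (tendsto_add_atTop_nat N))

lemma exists_subseq_discreteTendsto [Nonempty (Fin m)] (hf : ∀ j, IsSmoothClass (L j) (f j))
    (hθ0 : 0 < θ0) (hA : ∀ τ, 0 < τ → IsAPG f τ (√τ / θ0) x0 z0 (th τ) (x τ) (y τ) (z τ))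
    {u : ℕ → ℝ} (hu : Tendsto u atTop (𝓝[>] 0)) :
    ∃ φ : ℕ → ℕ, StrictMono φ ∧ ∃ (θ : ℝ → ℝ) (X Z : ℝ → E n),
      DiscreteTendsto atTop (fun i => u (φ i)) (fun i => th (u (φ i)))
        (fun i => x (u (φ i))) (fun i => z (u (φ i))) θ X Z := by
  obtain ⟨N, hN⟩ := exists_forall_ge_pos hu
  have hu0 : Tendsto (fun i => u (i + N)) atTop (𝓝 0) :=
    (tendsto_nhds_of_tendsto_nhdsWithin hu).comp (tendsto_add_atTop_nat N)
  have hs0 := tendsto_sqrt_zero hu0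
  obtain ⟨φ, hφ, g, hg⟩ := exists_subseq_tendstoUniformlyOn
    (fun i t => (x (u (i + N)) ⌊t / √(u (i + N))⌋₊, z (u (i + N)) ⌊t / √(u (i + N))⌋₊))
    (fun i => √(u (i + N))) hs0 fun T hT => by
      obtain ⟨C, hC, h0, hh0, hb⟩ := exists_apriori_bound hf hθ0 x0 z0 hT
      refine ⟨C, hC, ?_⟩
      filter_upwards [hs0.eventually_lt_const hh0] with i hi t ht
      have hs := Real.sqrt_pos.2 (hN i)
      have hk := hb _ _ _ _ _ (hN i) hi.le (hA _ (hN i))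
      have hft : (⌊t / √(u (i + N))⌋₊ : ℝ) * √(u (i + N)) ≤ T := by
        have := Nat.floor_le (div_nonneg ht.1 hs.le)
        rw [le_div_iff₀ hs] at this
        exact this.trans ht.2
      refine ⟨norm_prod_le_iff.2 ⟨(hk _ hft).1, (hk _ hft).2.1⟩, fun s hs' => ?_⟩
      exact norm_prod_le_iff.2 ⟨norm_path_sub_le hC hs (fun k hkT => (hk k hkT).2.2.1) hs' ht,
        norm_path_sub_le hC hs (fun k hkT => (hk k hkT).2.2.2) hs' ht⟩
  refine ⟨fun i => φ i + N, fun i j hij => Nat.add_lt_add_right (hφ hij) N,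
    fun t => t / 2 + θ0, fun t => (g t).1, fun t => (g t).2, fun T => ⟨?_, ?_, ?_⟩⟩
  · exact tendstoUniformlyOn_theta hθ0 (fun i => hN (φ i)) (hu0.comp hφ.tendsto_atTop)
      (fun i => hA _ (hN (φ i))) T
  · exact uniformContinuous_fst.comp_tendstoUniformlyOn (hg T)
  · exact uniformContinuous_snd.comp_tendstoUniformlyOn (hg T)

/-- If all solutions share the component `X`, then the solution is unique on `[0, ∞)`, as `θ` is
explicit and `Z = X + θ X'`; so every sequence of step sizes has a subsequence with this limit. -/
lemma discreteTendsto_of_unique [Nonempty (Fin m)] (hf : ∀ j, IsSmoothClass (L j) (f j))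
    (hθ0 : 0 < θ0) (hA : ∀ τ, 0 < τ → IsAPG f τ (√τ / θ0) x0 z0 (th τ) (x τ) (y τ) (z τ))
    {θ : ℝ → ℝ} {X Z : ℝ → E n} (hflow : IsFlow f θ0 x0 z0 θ X Z)
    (huniq : ∀ (θ' : ℝ → ℝ) (X' Z' : ℝ → E n), IsFlow f θ0 x0 z0 θ' X' Z' → EqOn X' X (Ici 0)) :
    DiscreteTendsto (𝓝[>] 0) (fun τ : ℝ => τ) th x z θ X Z := by
  have key : ∀ u : ℕ → ℝ, Tendsto u atTop (𝓝[>] 0) → ∃ φ : ℕ → ℕ,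
      DiscreteTendsto atTop (fun i => u (φ i)) (fun i => th (u (φ i)))
        (fun i => x (u (φ i))) (fun i => z (u (φ i))) θ X Z := by
    intro u hu
    obtain ⟨φ, hφ, θ', X', Z', hlim⟩ := exists_subseq_discreteTendsto hf hθ0 hA hu
    have hflow' := isFlow_of_discreteTendsto hf hθ0 hA (hu.comp hφ.tendsto_atTop) hlim
    have hX := huniq θ' X' Z' hflow'
    refine ⟨φ, fun T => ⟨(hlim T).1.congr_right fun t ht => ?_,
      (hlim T).2.1.congr_right fun t ht => hX ht.1, (hlim T).2.2.congr_right fun t ht => ?_⟩⟩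
    · rw [hflow'.theta_eq hθ0 ht.1, hflow.theta_eq hθ0 ht.1]
    · rw [hflow'.Z_eq ht.1, hflow.Z_eq ht.1, hflow'.theta_eq hθ0 ht.1, hflow.theta_eq hθ0 ht.1,
        hX ht.1, derivWithin_congr hX (hX ht.1)]
  refine fun T => ⟨tendstoUniformlyOn_of_subseq fun u hu => ?_,
    tendstoUniformlyOn_of_subseq fun u hu => ?_, tendstoUniformlyOn_of_subseq fun u hu => ?_⟩ <;>
  obtain ⟨φ, hφ⟩ := key u hu
  · exact ⟨φ, (hφ T).1⟩
  · exact ⟨φ, (hφ T).2.1⟩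
  · exact ⟨φ, (hφ T).2.2⟩

end Convergence

end MultiObj

theorem mainTheorem5 {n m : ℕ} (f : Fin m → MultiObj.E n → ℝ) (L : Fin m → ℝ≥0)
    (hf : ∀ j, MultiObj.IsSmoothClass (L j) (f j))
    (hlevel : ∃ j, ∀ α : ℝ, Bornology.IsBounded {w | f j w ≤ α})
    (θ0 : ℝ) (hθ0 : 0 < θ0) (x0 z0 : MultiObj.E n) :
    -- the method is well defined for every step size
    (∀ τ : ℝ, 0 < τ →
      ∃! s : (ℕ → ℝ) × (ℕ → MultiObj.E n) × (ℕ → MultiObj.E n) × (ℕ → MultiObj.E n),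
        MultiObj.IsAPG f τ (√τ / θ0) x0 z0 s.1 s.2.1 s.2.2.1 s.2.2.2) ∧
    -- its continuous-time limit is the first-order system
    (∀ (th : ℝ → ℕ → ℝ) (x y z : ℝ → ℕ → MultiObj.E n),
      (∀ τ, 0 < τ → MultiObj.IsAPG f τ (√τ / θ0) x0 z0 (th τ) (x τ) (y τ) (z τ)) →
      (∀ u : ℕ → ℝ, Tendsto u atTop (𝓝[>] 0) →
        ∃ φ : ℕ → ℕ, StrictMono φ ∧ ∃ (θ : ℝ → ℝ) (X Z : ℝ → MultiObj.E n),
          MultiObj.IsFlow f θ0 x0 z0 θ X Z ∧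
          MultiObj.DiscreteTendsto atTop (fun i => u (φ i)) (fun i => th (u (φ i)))
            (fun i => x (u (φ i))) (fun i => z (u (φ i))) θ X Z) ∧
      (∀ (u : ℕ → ℝ) (θ : ℝ → ℝ) (X Z : ℝ → MultiObj.E n), Tendsto u atTop (𝓝[>] 0) →
        MultiObj.DiscreteTendsto atTop u (fun i => th (u i)) (fun i => x (u i))
          (fun i => z (u i)) θ X Z →
        MultiObj.IsFlow f θ0 x0 z0 θ X Z) ∧
      (∀ (θ : ℝ → ℝ) (X Z : ℝ → MultiObj.E n), MultiObj.IsFlow f θ0 x0 z0 θ X Z →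
        (∀ (θ' : ℝ → ℝ) (X' Z' : ℝ → MultiObj.E n), MultiObj.IsFlow f θ0 x0 z0 θ' X' Z' →
          EqOn X' X (Ici 0)) →
        MultiObj.DiscreteTendsto (𝓝[>] 0) (fun τ : ℝ => τ) th x z θ X Z)) ∧
    -- the first-order system is equivalent to the second-order equation
    (∀ (θ : ℝ → ℝ) (X Z : ℝ → MultiObj.E n),
      MultiObj.IsFlow f θ0 x0 z0 θ X Z ↔
        (∀ t, 0 ≤ t → θ t = t / 2 + θ0) ∧
        (∀ t, 0 ≤ t → Z t = X t + θ t • derivWithin X (Ici 0) t) ∧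
        MultiObj.IsSecondOrderFlow f θ0 x0 (θ0⁻¹ • (z0 - x0)) X) := by
  have : Nonempty (Fin m) := let ⟨j, _⟩ := hlevel; ⟨j⟩
  refine ⟨fun τ hτ => MultiObj.existsUnique_isAPG f hτ _ x0 z0,
    fun th x y z hA => ⟨fun u hu => ?_, fun u θ X Z hu hlim => ?_, fun θ X Z h huniq => ?_⟩,
    fun θ X Z => ⟨fun h => ⟨fun t ht => h.theta_eq hθ0 ht, fun t ht => h.Z_eq ht,
      h.isSecondOrderFlow hθ0⟩, fun h => h.2.2.isFlow hθ0 h.1 h.2.1⟩⟩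
  · obtain ⟨φ, hφ, θ, X, Z, hlim⟩ := MultiObj.exists_subseq_discreteTendsto hf hθ0 hA hu
    exact ⟨φ, hφ, θ, X, Z,
      MultiObj.isFlow_of_discreteTendsto hf hθ0 hA (hu.comp hφ.tendsto_atTop) hlim, hlim⟩
  · exact MultiObj.isFlow_of_discreteTendsto hf hθ0 hA hu hlim
  · exact MultiObj.discreteTendsto_of_unique hf hθ0 hA h huniq
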